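/- Let $I_0=[a,b]$ with $a<b$, and let $(n_k)_{k\ge1}$ be integers with $n_k\ge2$, $(c_k)_{k\ge1}$ positive reals with $n_kc_k<1$, and $\xi_{k,l}\ge0$ ($k\ge1$, $0\le l\le n_k$) reals. Suppose that closed intervals $I_\sigma$, indexed by the finite words $\sigma=i_1\cdots i_k$ ($k\ge0$, $1\le i_j\le n_j$), satisfy $I_\emptyset=I_0$ and, for every $k\ge1$ and every word $\sigma$ of length $k-1$: $I_{\sigma*1},\dots,I_{\sigma*n_k}$ are closed subintervals of $I_\sigma$, ordered from left to right and overlapping at most in endpoints; $|I_{\sigma*j}|=c_k|I_\sigma|$ for $1\le j\le n_k$; $\min I_{\sigma*1}-\min I_\sigma=\xi_{k,0}$; $\min I_{\sigma*(l+1)}-\max I_{\sigma*l}=\xi_{k,l}$ for $1\le l\le n_k-1$; and $\max I_\sigma-\max I_{\sigma*n_k}=\xi_{k,n_k}$. Let $$E=E(I_0,\{n_k\},\{c_k\},\{\xi_{k,l}\})=\bigcap_{k\ge0}\ \bigcup_{|\sigma|=k}I_\sigma$$ be the corresponding homogeneous perfect set. Suppose that there is a real number $\chi\ge1$ with $$\max_{1\le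 l\le n_k-1}\xi_{k,l}\le\chi\min_{1\le l\le n_k-1}\xi_{k,l}\qquad\text{for all }k\ge1,$$ and that $\dim_PE=1$, where $\dim_P$ denotes packing dimension. Then $\dim_Pf(E)=1$ for every quasisymmetric mapping $f:\mathbb R\to\mathbb R$, that is, for every homeomorphism $f$ of $\mathbb R$ for which there is a homeomorphism $\eta:[0,\infty)\to[0,\infty)$ with $$\frac{|f(x)-f(a')|}{|f(x)-f(b')|}\le\eta\left(\frac{|x-a'|}{|x-b'|}\right)\qquad\text{for all }a',b',x\in\mathbb R\text{ with }x\ne b'.$$ In particular, $E$ is quasisymmetrically packing minimal: $\dim_Pf(E)\ge\dim_PE$ for every such $f$. -/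

import Mathlib

open Set
open scoped NNReal ENNReal

/-! ### Packing measure and packing dimension on the real line -/

/-- A finite `δ`-packing of `A`: finitely many pairwise disjoint closed balls, each given as a pair
(centre, radius), with centres in `A` and radii in `(0, δ]`. -/
def IsPacking (δ : ℝ) (A : Set ℝ) (t : Finset (ℝ × ℝ)) : Prop :=
  (∀ p ∈ t, p.1 ∈ A ∧ 0 < p.2 ∧ p.2 ≤ δ) ∧
    (t : Set (ℝ × ℝ)).PairwiseDisjoint fun p => Metric.closedBall p.1 p.2

/-- The supremum of `∑ |B|ˢ` over the `δ`-packings of `A`; the ball of radius `r` has diameter `2r`.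
The supremum over finite packings equals the one over countable packings. -/
noncomputable def packingSup (s : ℝ≥0) (δ : ℝ) (A : Set ℝ) : ℝ≥0∞ :=
  ⨆ (t : Finset (ℝ × ℝ)) (_ : IsPacking δ A t), ∑ p ∈ t, ENNReal.ofReal (2 * p.2) ^ (s : ℝ)

/-- The `s`-dimensional packing premeasure (the limit of `packingSup s δ A` as `δ` decreases to 0). -/
noncomputable def packingPremeasure (s : ℝ≥0) (A : Set ℝ) : ℝ≥0∞ :=
  ⨅ (δ : ℝ) (_ : 0 < δ), packingSup s δ A

/-- The `s`-dimensional packing measure of `A`. -/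
noncomputable def packingMeasure (s : ℝ≥0) (A : Set ℝ) : ℝ≥0∞ :=
  ⨅ (U : ℕ → Set ℝ) (_ : A ⊆ ⋃ i, U i), ∑' i, packingPremeasure s (U i)

/-- The packing dimension: the critical exponent of the packing measure (with value `0` if the
packing measure is finite for every exponent). -/
noncomputable def packingDim (A : Set ℝ) : ℝ≥0∞ :=
  ⨆ (s : ℝ≥0) (_ : packingMeasure s A = ∞), (s : ℝ≥0∞)

/-! ### Quasisymmetric maps of the real line -/

/-- A quasisymmetric homeomorphism of the line, with `η` a homeomorphism of `[0, ∞)` onto itself. -/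
def IsQuasisymmetric (f : ℝ → ℝ) : Prop :=
  IsHomeomorph f ∧ ∃ η : ℝ≥0 ≃ₜ ℝ≥0, ∀ a b x : ℝ, x ≠ b →
    nndist (f x) (f a) / nndist (f x) (f b) ≤ η (nndist x a / nndist x b)

/-- Quasisymmetric maps of the line do not lower the packing dimension of `E`. -/
def IsQuasisymmetricallyPackingMinimal (E : Set ℝ) : Prop :=
  ∀ f : ℝ → ℝ, IsQuasisymmetric f → packingDim E ≤ packingDim (f '' E)

/-! ### Homogeneous perfect sets

The sequences `n`, `c`, `ξ` are indexed by `k ≥ 1`; their entries at `k = 0` are never used. -/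

/-- `words n k` is the set of words `i₁ ⋯ i_k` with `1 ≤ i_j ≤ n j`. -/
def words (n : ℕ → ℕ) : ℕ → Set (List ℕ)
  | 0 => {[]}
  | k + 1 => {τ | ∃ σ ∈ words n k, ∃ j ∈ Finset.Icc 1 (n (k + 1)), τ = σ ++ [j]}

/-- The intervals `I_σ = [lo σ, hi σ]`, for `σ` a word, have homogeneous perfect structure with
initial interval `[a, b]` and parameters `n`, `c`, `ξ`. -/
structure HasHomogeneousPerfectStructure (a b : ℝ) (n : ℕ → ℕ) (c : ℕ → ℝ) (ξ : ℕ → ℕ → ℝ)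
    (lo hi : List ℕ → ℝ) : Prop where
  two_le : ∀ k, 2 ≤ n (k + 1)
  c_pos : ∀ k, 0 < c (k + 1)
  mul_lt_one : ∀ k, (n (k + 1) : ℝ) * c (k + 1) < 1
  gap_nonneg : ∀ k, ∀ l ≤ n (k + 1), 0 ≤ ξ (k + 1) l
  initial_lt : a < b
  lo_nil : lo [] = a
  hi_nil : hi [] = b
  subset : ∀ k, ∀ σ ∈ words n k, ∀ j ∈ Finset.Icc 1 (n (k + 1)),
    Icc (lo (σ ++ [j])) (hi (σ ++ [j])) ⊆ Icc (lo σ) (hi σ)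
  ordered : ∀ k, ∀ σ ∈ words n k, ∀ l ∈ Finset.Icc 1 (n (k + 1) - 1),
    hi (σ ++ [l]) ≤ lo (σ ++ [l + 1])
  ratio : ∀ k, ∀ σ ∈ words n k, ∀ j ∈ Finset.Icc 1 (n (k + 1)),
    (hi (σ ++ [j]) - lo (σ ++ [j])) / (hi σ - lo σ) = c (k + 1)
  gap_left : ∀ k, ∀ σ ∈ words n k, lo (σ ++ [1]) - lo σ = ξ (k + 1) 0
  gap : ∀ k, ∀ σ ∈ words n k, ∀ l ∈ Finset.Icc 1 (n (k + 1) - 1),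
    lo (σ ++ [l + 1]) - hi (σ ++ [l]) = ξ (k + 1) l
  gap_right : ∀ k, ∀ σ ∈ words n k, hi σ - hi (σ ++ [n (k + 1)]) = ξ (k + 1) (n (k + 1))

/-- `E = E([a, b], {n_k}, {c_k}, {ξ_{k,l}})` is a homogeneous perfect set: `E = ⋂ₖ Eₖ`, where `Eₖ`
is the union of the basic intervals of order `k`. -/
def IsHomogeneousPerfectSet (a b : ℝ) (n : ℕ → ℕ) (c : ℕ → ℝ) (ξ : ℕ → ℕ → ℝ)
    (E : Set ℝ) : Prop :=
  ∃ lo hi : List ℕ → ℝ, HasHomogeneousPerfectStructure a b n c ξ lo hi ∧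
    E = ⋂ k, ⋃ σ ∈ words n k, Icc (lo σ) (hi σ)

/-!
That the packing dimension is `1` can be expressed through the parameters of the set, and the resulting
condition survives a quasisymmetric map.

Replacing each basic interval by the convex hull of the part of `E` in it removes the gaps at the two
ends of the interval. The hulls `[u σ, u σ + d k]` of order `k` still have equal lengths, and the gaps
between the children of a hull are still within the factor `χ` of each other (`HullTree`,
`HasHomogeneousPerfectStructure.hullTree`). Write `N k` for the number of words of length `k`
(`wordCount`). As the gaps are comparable, a ball of radius `r` centred in `E`, with `d (k + 1)` below
and `d k` above the scale of `r`, has mass at least of order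
`max 1 (r * n (k + 1) / d k) / N (k + 1)` for the uniform mass distribution. If
`N k * d k ≤ N (k + 1) ^ (-ε)` for all large `k`, this is at least of order `r ^ s` with
`s = 1 / (1 + ε) < 1`, and `dim_P E ≤ s`. Hence `dim_P E = 1` forces
`N k * d k > N (k + 1) ^ (-ε)` infinitely often, for each `ε > 0` (`HullTree.exists_rpow_lt`).

Conversely, let `f` be quasisymmetric. All that is used of `f` is that adjacent intervals of equal
length have images of comparable length (`IsDoublingSize`). For each `θ < 1` there is then an exponent
`A` such that, if the children of a hull fill the proportion `t` of it, their images fill at least the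
proportion `θ * t ^ A` of its image (`HullTree.exists_size_children_ge`). So the images of the hulls of
order `k` have total length at least of order `θ ^ k * (N k * d k) ^ A`. Since `N (k + 1) ≥ 2 ^ (k + 1)`,
for `θ` close to `1` and `ε` small this exceeds any prescribed negative power of `N (k + 1)` for
infinitely many `k`. For such `k`, the images of the left endpoints of the hulls of order `k + 1` are
the centres of a packing with balls of total length of the same order, while Hölder continuity of `f`
bounds each radius by `C * N (k + 1) ^ (-q)`. For `s < 1` the sum of the `s`-th powers of the diameters
is therefore unbounded (`HullTree.packingPremeasure_image_eq_top`). The same holds for the part of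
`E` in any hull, so every nonempty relatively open subset of `f '' E` has infinite `s`-dimensional
packing premeasure, and by Baire's theorem `f '' E` has infinite `s`-dimensional packing measure
(`packingMeasure_eq_top_of_forall_isOpen`).
-/

/-! ### Packings -/

theorem packingSup_mono (s : ℝ≥0) (δ : ℝ) {A B : Set ℝ} (h : A ⊆ B) :
    packingSup s δ A ≤ packingSup s δ B :=
  iSup₂_le fun t ht => le_iSup₂ (f := fun t (_ : IsPacking δ B t) =>
    ∑ p ∈ t, ENNReal.ofReal (2 * p.2) ^ (s : ℝ)) t ⟨fun p hp => ⟨h (ht.1 p hp).1, (ht.1 p hp).2⟩, ht.2⟩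

theorem packingPremeasure_mono (s : ℝ≥0) {A B : Set ℝ} (h : A ⊆ B) :
    packingPremeasure s A ≤ packingPremeasure s B :=
  iInf₂_mono fun δ _ => packingSup_mono s δ h

/-- Two closed balls of the line with nonnegative radii are disjoint exactly when their centres
are farther apart than the sum of the radii. -/
theorem disjoint_closedBall_iff {x y r r' : ℝ} (hr : 0 ≤ r) (hr' : 0 ≤ r') :
    Disjoint (Metric.closedBall x r) (Metric.closedBall y r') ↔ r + r' < |x - y| := by
  refine ⟨fun h => ?_, fun h => Metric.closedBall_disjoint_closedBall (by rwa [Real.dist_eq])⟩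
  by_contra! hle
  rw [Set.disjoint_left] at h
  rw [Real.closedBall_eq_Icc, Real.closedBall_eq_Icc] at h
  rw [abs_le] at hle
  refine h (a := max (x - r) (y - r')) ⟨le_max_left _ _, ?_⟩ ⟨le_max_right _ _, ?_⟩ <;>
    apply max_le <;> linarith

theorem sum_le_packingSup {ι : Type*} (S : Finset ι) (x r : ι → ℝ) (s : ℝ≥0) (δ : ℝ)
    (A : Set ℝ) (hx : ∀ i ∈ S, x i ∈ A) (hr : ∀ i ∈ S, 0 < r i) (hδ : ∀ i ∈ S, r i ≤ δ)
    (hd : ∀ i ∈ S, ∀ j ∈ S, i ≠ j → r i + r j < |x i - x j|) :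
    ∑ i ∈ S, ENNReal.ofReal (2 * r i) ^ (s : ℝ) ≤ packingSup s δ A := by
  classical
  have hinj : Set.InjOn (fun i => (x i, r i)) (S : Set ι) := by
    intro i hi j hj hij
    by_contra hne
    have h1 := hd i hi j hj hne
    simp only [Prod.mk.injEq] at hij
    rw [hij.1, sub_self, abs_zero] at h1
    linarith [hr i hi, hr j hj]
  rw [← Finset.sum_image (f := fun p : ℝ × ℝ => ENNReal.ofReal (2 * p.2) ^ (s : ℝ)) hinj]
  refine le_iSup₂ (f := fun t (_ : IsPacking δ A t) =>
    ∑ p ∈ t, ENNReal.ofReal (2 * p.2) ^ (s : ℝ)) _ ⟨?_, ?_⟩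
  · intro p hp
    obtain ⟨i, hi, rfl⟩ := Finset.mem_image.1 hp
    exact ⟨hx i hi, hr i hi, hδ i hi⟩
  · intro p hp q hq hpq
    obtain ⟨i, hi, rfl⟩ := Finset.mem_image.1 (Finset.mem_coe.1 hp)
    obtain ⟨j, hj, rfl⟩ := Finset.mem_image.1 (Finset.mem_coe.1 hq)
    exact (disjoint_closedBall_iff (hr i hi).le (hr j hj).le).2
      (hd i hi j hj fun h => hpq (by rw [h]))

/-- The centres of a finite packing can be moved slightly without making the balls meet, so a set
has the same packings, up to an arbitrarily small motion, as its closure. -/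
theorem packingSup_closure_le (s : ℝ≥0) (δ : ℝ) (A : Set ℝ) :
    packingSup s δ (closure A) ≤ packingSup s δ A := by
  refine iSup₂_le fun t ht => ?_
  have hev : ∀ᶠ ε in nhdsWithin (0 : ℝ) (Ioi 0), ∀ p ∈ t, ∀ q ∈ t, p ≠ q →
      p.2 + q.2 + 2 * ε < |p.1 - q.1| := by
    rw [Filter.eventually_all_finset]
    intro p hp
    rw [Filter.eventually_all_finset]
    intro q hq
    by_cases hpq : p = q
    · simp [hpq]
    have h1 := (disjoint_closedBall_iff (ht.1 p hp).2.1.le (ht.1 q hq).2.1.le).1 (ht.2 hp hq hpq)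
    have h2 : Filter.Tendsto (fun ε : ℝ => p.2 + q.2 + 2 * ε) (nhdsWithin 0 (Ioi 0))
        (nhds (p.2 + q.2 + 2 * 0)) :=
      (Continuous.tendsto (by fun_prop) _).mono_left nhdsWithin_le_nhds
    filter_upwards [h2.eventually_lt_const (by simpa using h1)] with ε hε _ using hε
  obtain ⟨ε, hε, hε0⟩ := (hev.and self_mem_nhdsWithin).exists
  have hch : ∀ p : ℝ × ℝ, ∃ y, p ∈ t → y ∈ A ∧ |p.1 - y| < ε := by
    intro p
    by_cases hp : p ∈ t
    · obtain ⟨y, hy, hyd⟩ := Metric.mem_closure_iff.1 (ht.1 p hp).1 ε hε0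
      exact ⟨y, fun _ => ⟨hy, by rwa [Real.dist_eq] at hyd⟩⟩
    · exact ⟨0, fun h => absurd h hp⟩
  choose y hy using hch
  refine sum_le_packingSup t y Prod.snd s δ A (fun p hp => (hy p hp).1)
    (fun p hp => (ht.1 p hp).2.1) (fun p hp => (ht.1 p hp).2.2) fun p hp q hq hpq => ?_
  have h1 := hε p hp q hq hpq
  have h2 := (hy p hp).2
  have h3 := (hy q hq).2
  have h4 : |p.1 - q.1| ≤ |p.1 - y p| + |y p - y q| + |q.1 - y q| := by
    rw [abs_sub_comm q.1]
    calc |p.1 - q.1| = |(p.1 - y p) + (y p - y q) + (y q - q.1)| := by ring_nf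
      _ ≤ _ := abs_add_three _ _ _
  linarith

theorem packingPremeasure_closure_le (s : ℝ≥0) (A : Set ℝ) :
    packingPremeasure s (closure A) ≤ packingPremeasure s A :=
  iInf₂_mono fun δ _ => packingSup_closure_le s δ A

theorem packingPremeasure_empty (s : ℝ≥0) : packingPremeasure s ∅ = 0 := by
  refine le_antisymm ((iInf₂_le (1 : ℝ) one_pos).trans ?_) bot_le
  refine iSup₂_le fun t ht => ?_
  rw [Finset.eq_empty_of_forall_notMem fun p hp => (ht.1 p hp).1]
  simp

theorem packingMeasure_le_packingPremeasure (s : ℝ≥0) (A : Set ℝ) :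
    packingMeasure s A ≤ packingPremeasure s A := by
  refine (iInf₂_le (fun i : ℕ => if i = 0 then A else ∅)
    fun x hx => mem_iUnion.2 ⟨0, by simpa using hx⟩).trans ?_
  rw [tsum_eq_single 0 (fun i hi => by simp [hi, packingPremeasure_empty])]
  simp

theorem packingMeasure_ne_top_of_packingSup_le {s : ℝ≥0} {A : Set ℝ} {δ : ℝ} (hδ : 0 < δ)
    {C : ℝ} (h : ∀ t, IsPacking δ A t → ∑ p ∈ t, (2 * p.2) ^ (s : ℝ) ≤ C) :
    packingMeasure s A ≠ ∞ := by
  refine ne_top_of_le_ne_top (ENNReal.ofReal_ne_top (r := C))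
    ((packingMeasure_le_packingPremeasure s A).trans ((iInf₂_le δ hδ).trans ?_))
  refine iSup₂_le fun t ht => (le_of_eq ?_).trans (ENNReal.ofReal_le_ofReal (h t ht))
  have h0 : ∀ p ∈ t, 0 < 2 * p.2 := fun p hp => by linarith [(ht.1 p hp).2.1]
  rw [ENNReal.ofReal_sum_of_nonneg fun p hp => Real.rpow_nonneg (h0 p hp).le _]
  exact Finset.sum_congr rfl fun p hp => ENNReal.ofReal_rpow_of_pos (h0 p hp)

/-- Disjoint balls centred in a bounded set have bounded total length. -/
theorem packingMeasure_ne_top_of_one_le {s : ℝ≥0} (hs : 1 ≤ s) {A : Set ℝ} {a b : ℝ}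
    (hA : A ⊆ Icc a b) : packingMeasure s A ≠ ∞ := by
  refine packingMeasure_ne_top_of_packingSup_le (δ := 1 / 2) (by norm_num)
    (C := max 0 (b - a + 1)) fun t ht => ?_
  have h1 : ∑ p ∈ t, (2 * p.2) ^ (s : ℝ) ≤ ∑ p ∈ t, 2 * p.2 := by
    refine Finset.sum_le_sum fun p hp => ?_
    have := ht.1 p hp
    calc (2 * p.2) ^ (s : ℝ) ≤ (2 * p.2) ^ (1 : ℝ) :=
          Real.rpow_le_rpow_of_exponent_ge (by linarith) (by linarith) (by exact_mod_cast hs)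
      _ = 2 * p.2 := Real.rpow_one _
  refine h1.trans ?_
  have h2 : MeasureTheory.volume (⋃ p ∈ t, Metric.closedBall p.1 p.2) =
      ∑ p ∈ t, ENNReal.ofReal (2 * p.2) := by
    rw [MeasureTheory.measure_biUnion_finset ht.2 fun p _ => measurableSet_closedBall]
    simp
  have h3 : MeasureTheory.volume (⋃ p ∈ t, Metric.closedBall p.1 p.2) ≤
      ENNReal.ofReal (b - a + 1) := by
    have : (⋃ p ∈ t, Metric.closedBall p.1 p.2) ⊆ Icc (a - 1 / 2) (b + 1 / 2) := by
      refine iUnion₂_subset fun p hp => ?_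
      have h := ht.1 p hp
      have h' := hA h.1
      rw [Real.closedBall_eq_Icc]
      exact Icc_subset_Icc (by linarith [h'.1]) (by linarith [h'.2])
    refine (MeasureTheory.measure_mono this).trans ?_
    rw [Real.volume_Icc]
    exact ENNReal.ofReal_le_ofReal (by linarith)
  have h0 : ∀ p ∈ t, 0 ≤ 2 * p.2 := fun p hp => by linarith [(ht.1 p hp).2.1]
  rw [h2, ← ENNReal.ofReal_sum_of_nonneg h0] at h3
  rw [max_comm]
  by_contra! hlt
  rw [max_lt_iff] at hlt
  exact absurd h3 (not_le.2 ((ENNReal.ofReal_lt_ofReal_iff hlt.2).2 hlt.1))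

theorem packingDim_le_of_forall {A : Set ℝ} {s₀ : ℝ≥0}
    (h : ∀ s : ℝ≥0, s₀ < s → packingMeasure s A ≠ ∞) : packingDim A ≤ s₀ := by
  refine iSup₂_le fun s hs => ?_
  by_contra! hlt
  exact h s (by exact_mod_cast hlt) hs

theorem one_le_packingDim_of_forall {A : Set ℝ}
    (h : ∀ s : ℝ≥0, s < 1 → packingMeasure s A = ∞) : 1 ≤ packingDim A := by
  refine le_of_forall_lt fun c hc => ?_
  obtain ⟨r, hr, hr1⟩ := ENNReal.lt_iff_exists_nnreal_btwn.1 hc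
  exact hr.trans_le (le_iSup₂ (f := fun (s : ℝ≥0) (_ : packingMeasure s A = ∞) => (s : ℝ≥0∞)) r
    (h r (by exact_mod_cast hr1)))

/-- A closed set has infinite packing measure as soon as each of its nonempty relatively open
subsets has infinite packing premeasure: by Baire's theorem, the closure of one member of any
countable cover contains such a subset. -/
theorem packingMeasure_eq_top_of_forall_isOpen {s : ℝ≥0} {K : Set ℝ} (hK : IsClosed K)
    (hne : K.Nonempty)
    (h : ∀ V : Set ℝ, IsOpen V → (K ∩ V).Nonempty → packingPremeasure s (K ∩ V) = ∞) :
    packingMeasure s K = ∞ := by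
  refine iInf₂_eq_top.2 fun U hU => ?_
  have : Nonempty K := hne.to_subtype
  have : CompleteSpace K := hK.completeSpace_coe
  obtain ⟨i, x, hx⟩ := nonempty_interior_of_iUnion_of_closed
    (f := fun i => (Subtype.val : K → ℝ) ⁻¹' closure (U i))
    (fun i => isClosed_closure.preimage continuous_subtype_val) (by
      refine eq_univ_of_forall fun y => ?_
      obtain ⟨i, hi⟩ := mem_iUnion.1 (hU y.2)
      exact mem_iUnion.2 ⟨i, subset_closure hi⟩)
  obtain ⟨W, hWU, hWo, hxW⟩ := mem_interior.1 hx
  obtain ⟨V, hV, rfl⟩ := isOpen_induced_iff.1 hWo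
  have hsub : K ∩ V ⊆ closure (U i) := fun y hy => hWU (a := ⟨y, hy.1⟩) hy.2
  have h1 : packingPremeasure s (U i) = ∞ := by
    refine top_le_iff.1 ?_
    rw [← h V hV ⟨x, x.2, hxW⟩]
    exact (packingPremeasure_mono s hsub).trans (packingPremeasure_closure_le s _)
  exact top_le_iff.1 (h1 ▸ ENNReal.le_tsum i)

/-! ### Doubling interval functions -/

/-- An additive interval function on the line, `D x y` being the size of `[x, y]` for `x ≤ y`, such
that any two adjacent intervals of equal length have sizes within a factor `H` of each other. The
lengths of the images of intervals under a quasisymmetric map are of this kind. -/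
structure IsDoublingSize (D : ℝ → ℝ → ℝ) (H : ℝ) : Prop where
  one_le : 1 ≤ H
  pos : ∀ {x y}, x < y → 0 < D x y
  add : ∀ {x y z}, x ≤ y → y ≤ z → D x z = D x y + D y z
  right_le : ∀ x {h}, 0 ≤ h → D x (x + h) ≤ H * D (x - h) x
  left_le : ∀ x {h}, 0 ≤ h → D (x - h) x ≤ H * D x (x + h)

namespace IsDoublingSize

variable {D : ℝ → ℝ → ℝ} {H : ℝ}

theorem self (hD : IsDoublingSize D H) (x : ℝ) : D x x = 0 := by
  have := hD.add (le_refl x) (le_refl x)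
  linarith

theorem nonneg (hD : IsDoublingSize D H) {x y : ℝ} (h : x ≤ y) : 0 ≤ D x y := by
  rcases h.eq_or_lt with rfl | h
  · exact (hD.self x).ge
  · exact (hD.pos h).le

theorem mono (hD : IsDoublingSize D H) {x y x' y' : ℝ} (hx : x' ≤ x) (hxy : x ≤ y) (hy : y ≤ y') :
    D x y ≤ D x' y' := by
  have h1 := hD.add hx (hxy.trans hy)
  have h2 := hD.add hxy hy
  linarith [hD.nonneg hx, hD.nonneg hy]

/-- Enlarging an interval to the right by a factor `2 ^ m`. -/
theorem dilate_le (hD : IsDoublingSize D H) (x : ℝ) {h : ℝ} (hh : 0 ≤ h) (m : ℕ) :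
    D x (x + 2 ^ m * h) ≤ (1 + H) ^ m * D x (x + h) := by
  have h1 := hD.one_le
  induction m with
  | zero => simp
  | succ m ih =>
    have hm : 0 ≤ 2 ^ m * h := by positivity
    have h2 := hD.right_le (x + 2 ^ m * h) hm
    have h3 := hD.add (x := x) (y := x + 2 ^ m * h) (z := x + 2 ^ (m + 1) * h) (by linarith)
      (by rw [pow_succ]; linarith)
    rw [show x + 2 ^ m * h + 2 ^ m * h = x + 2 ^ (m + 1) * h by ring, add_sub_cancel_right] at h2
    calc D x (x + 2 ^ (m + 1) * h) ≤ (1 + H) * D x (x + 2 ^ m * h) := by linarith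
      _ ≤ (1 + H) * ((1 + H) ^ m * D x (x + h)) := by gcongr
      _ = _ := by ring

theorem right_dilate_le (hD : IsDoublingSize D H) (x : ℝ) {h l : ℝ} (hh : 0 ≤ h) (hl : 0 ≤ l)
    (m : ℕ) (hm : l ≤ 2 ^ m * h) :
    D x (x + l) ≤ H * (1 + H) ^ m * D (x - h) x := by
  have h1 := hD.one_le
  calc D x (x + l) ≤ D x (x + 2 ^ m * h) := hD.mono le_rfl (by linarith) (by linarith)
    _ ≤ (1 + H) ^ m * D x (x + h) := hD.dilate_le x hh m
    _ ≤ (1 + H) ^ m * (H * D (x - h) x) := by gcongr; exact hD.right_le x hh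
    _ = _ := by ring

/-- Shrinking an interval by a factor `2 ^ m` towards its left endpoint. -/
theorem shrink_left_le (hD : IsDoublingSize D H) (x : ℝ) {h : ℝ} (hh : 0 ≤ h) (m : ℕ) :
    D x (x + h) ≤ (H / (1 + H)) ^ m * D x (x + 2 ^ m * h) := by
  have h1 := hD.one_le
  induction m with
  | zero => simp
  | succ m ih =>
    have hm : 0 ≤ 2 ^ m * h := by positivity
    have h2 := hD.left_le (x + 2 ^ m * h) hm
    have h3 := hD.add (x := x) (y := x + 2 ^ m * h) (z := x + 2 ^ (m + 1) * h) (by linarith)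
      (by rw [pow_succ]; linarith)
    rw [show x + 2 ^ m * h + 2 ^ m * h = x + 2 ^ (m + 1) * h by ring, add_sub_cancel_right] at h2
    have h4 : D x (x + 2 ^ m * h) ≤ H / (1 + H) * D x (x + 2 ^ (m + 1) * h) := by
      rw [div_mul_eq_mul_div, le_div_iff₀ (by linarith), h3]
      linarith
    calc D x (x + h) ≤ (H / (1 + H)) ^ m * D x (x + 2 ^ m * h) := ih
      _ ≤ (H / (1 + H)) ^ m * (H / (1 + H) * D x (x + 2 ^ (m + 1) * h)) := by gcongr
      _ = _ := by ring

theorem reflect (hD : IsDoublingSize D H) : IsDoublingSize (fun x y => D (-y) (-x)) H where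
  one_le := hD.one_le
  pos h := hD.pos (by linarith)
  add h h' := by
    rw [hD.add (neg_le_neg h') (neg_le_neg h), add_comm]
  right_le x h hh := by
    simpa [sub_eq_add_neg, add_comm] using hD.left_le (-x) hh
  left_le x h hh := by
    simpa [sub_eq_add_neg, add_comm] using hD.right_le (-x) hh

theorem shrink_right_le (hD : IsDoublingSize D H) (x : ℝ) {h : ℝ} (hh : 0 ≤ h) (m : ℕ) :
    D (x - h) x ≤ (H / (1 + H)) ^ m * D (x - 2 ^ m * h) x := by
  simpa [sub_eq_add_neg, add_comm] using hD.reflect.shrink_left_le (-x) hh m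

theorem right_shrink_le (hD : IsDoublingSize D H) (x : ℝ) {h l : ℝ} (hl : 0 ≤ l)
    (m : ℕ) (hm : 2 ^ m * l ≤ h) :
    D x (x + l) ≤ H * (H / (1 + H)) ^ m * D (x - h) x := by
  have h1 := hD.one_le
  have h0 : 0 ≤ 2 ^ m * l := by positivity
  calc D x (x + l) ≤ (H / (1 + H)) ^ m * D x (x + 2 ^ m * l) := hD.shrink_left_le x hl m
    _ ≤ (H / (1 + H)) ^ m * D x (x + h) := by
        gcongr; exact hD.mono le_rfl (by linarith) (by linarith)
    _ ≤ (H / (1 + H)) ^ m * (H * D (x - h) x) := by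
        gcongr; exact hD.right_le x (h0.trans hm)
    _ = _ := by ring

theorem subinterval_le (hD : IsDoublingSize D H) {u v x y : ℝ} (hux : u ≤ x) (hxy : x ≤ y)
    (hyv : y ≤ v) (m : ℕ) (hm : 2 ^ (m + 1) * (y - x) ≤ v - u) :
    D x y ≤ (H / (1 + H)) ^ m * D u v := by
  have h1 := hD.one_le
  have h0 : 0 ≤ 2 ^ m * (y - x) := mul_nonneg (by positivity) (by linarith)
  have hle : y - x ≤ 2 ^ m * (y - x) :=
    le_mul_of_one_le_left (by linarith) (one_le_pow₀ (by norm_num))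
  rw [pow_succ] at hm
  by_cases hc : x + 2 ^ m * (y - x) ≤ v
  · have := hD.shrink_left_le x (h := y - x) (by linarith) m
    rw [add_sub_cancel] at this
    refine this.trans ?_
    gcongr
    exact hD.mono hux (by linarith) hc
  · have := hD.shrink_right_le y (h := y - x) (by linarith) m
    rw [sub_sub_cancel] at this
    refine this.trans ?_
    gcongr
    exact hD.mono (by linarith) (by linarith) hyv

/-- Doubling interval functions are Hölder continuous on bounded intervals. -/
theorem exists_holder (hD : IsDoublingSize D H) : ∃ q : ℝ, 0 < q ∧ ∀ u v : ℝ, u < v →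
    ∃ C : ℝ, 0 < C ∧ ∀ x y, u ≤ x → x < y → y ≤ v → D x y ≤ C * (y - x) ^ q := by
  have h1 := hD.one_le
  set ρ := H / (1 + H) with hρ
  have hρ0 : 0 < ρ := by positivity
  have hρ1 : ρ < 1 := by rw [hρ, div_lt_one (by linarith)]; linarith
  have hq : 0 < - Real.logb 2 ρ := by
    have := Real.logb_neg (b := 2) (by norm_num) hρ0 hρ1
    linarith
  -- the exponent satisfies `2 ^ (-q) = ρ`
  have h2q : (2 : ℝ) ^ (Real.logb 2 ρ) = ρ := Real.rpow_logb (by norm_num) (by norm_num) hρ0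
  refine ⟨- Real.logb 2 ρ, hq, fun u v huv => ?_⟩
  set q := - Real.logb 2 ρ with hqd
  have hL : 0 < v - u := by linarith
  refine ⟨ρ⁻¹ ^ 2 * D u v * ((v - u) ^ q)⁻¹, mul_pos (mul_pos (by positivity) (hD.pos huv))
    (inv_pos.2 (Real.rpow_pos_of_pos hL _)), fun x y hux hxy hyv => ?_⟩
  have hh : 0 < y - x := by linarith
  obtain ⟨m, hm, hm'⟩ := exists_nat_pow_near (x := (v - u) / (y - x)) (y := (2 : ℝ))
    (by rw [le_div_iff₀ hh]; linarith) (by norm_num)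
  have hDuv := (hD.pos huv).le
  have key : D x y ≤ ρ⁻¹ ^ 2 * ρ ^ (m + 1) * D u v := by
    rcases m with _ | m
    · have : 1 ≤ ρ⁻¹ := (one_le_inv₀ hρ0).2 hρ1.le
      calc D x y ≤ D u v := hD.mono hux hxy.le hyv
        _ ≤ ρ⁻¹ * D u v := le_mul_of_one_le_left hDuv this
        _ = _ := by field_simp; ring
    · refine (hD.subinterval_le hux hxy.le hyv m ?_).trans (le_of_eq ?_)
      · rwa [le_div_iff₀ hh] at hm
      · rw [← hρ]; field_simp; ring
  have hpow : ρ ^ (m + 1) ≤ ((v - u) ^ q)⁻¹ * (y - x) ^ q := by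
    have e1 : ρ ^ (m + 1) = (((2 : ℝ) ^ (m + 1)) ^ q)⁻¹ := by
      rw [← Real.rpow_neg (by positivity), hqd, neg_neg, ← Real.rpow_natCast 2,
        ← Real.rpow_mul (by norm_num), mul_comm, Real.rpow_mul (by norm_num), h2q,
        Real.rpow_natCast]
    have e2 : ((v - u) ^ q)⁻¹ * (y - x) ^ q = (((v - u) / (y - x)) ^ q)⁻¹ := by
      rw [Real.div_rpow hL.le hh.le, inv_div]; ring
    rw [e1, e2]
    gcongr
  calc D x y ≤ ρ⁻¹ ^ 2 * ρ ^ (m + 1) * D u v := key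
    _ ≤ ρ⁻¹ ^ 2 * (((v - u) ^ q)⁻¹ * (y - x) ^ q) * D u v := by gcongr
    _ = _ := by ring

/-- Comparison of an interval `[x - d, x]` with an adjacent gap `[x, x + l]`. Here `y - 1` is, up to
the factor `B`, a bound for the ratio `l / d`. Adding the gap multiplies the size by at most `θ⁻¹` when
`y` is close to `1`, and by at most a power of `y` otherwise. -/
theorem exists_gap_le (hD : IsDoublingSize D H) {θ : ℝ} (hθ0 : 0 < θ) (hθ : θ < 1) {B : ℝ}
    (hB : 0 < B) : ∃ A : ℕ, ∀ x d l y : ℝ, 0 < d → 0 ≤ l → 1 ≤ y → l ≤ B * (y - 1) * d →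
      D (x - d) x + D x (x + l) ≤ θ⁻¹ * y ^ A * D (x - d) x := by
  have h1 := hD.one_le
  set ρ := H / (1 + H) with hρ
  have hρ0 : 0 < ρ := by positivity
  have hρ1 : ρ < 1 := by rw [hρ, div_lt_one (by linarith)]; linarith
  have hθi : 1 < θ⁻¹ := (one_lt_inv₀ hθ0).2 hθ
  obtain ⟨m₀, hm₀⟩ := exists_pow_lt_of_lt_one (x := (θ⁻¹ - 1) / H) (div_pos (by linarith)
    (by linarith)) hρ1
  rw [lt_div_iff₀ (by linarith)] at hm₀
  obtain ⟨m₁, hm₁⟩ := pow_unbounded_of_one_lt B (by norm_num : (1 : ℝ) < 2)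
  -- `z` is the threshold between the regimes of short and long gaps
  set z : ℝ := min 2 (1 + 1 / (B * 2 ^ m₀)) with hz
  have hz1 : 1 < z := lt_min (by norm_num) (by linarith [show 0 < 1 / (B * 2 ^ m₀) by positivity])
  set C : ℝ := 1 + H * (1 + H) ^ (m₁ + 1) with hC
  obtain ⟨A, hA⟩ := pow_unbounded_of_one_lt (C * (1 + H)) hz1
  refine ⟨A, fun x d l y hd hl hy hly => ?_⟩
  have hD0 : 0 ≤ D (x - d) x := hD.nonneg (by linarith)
  by_cases hyz : y < z
  · have hy2 : y - 1 < 1 / (B * 2 ^ m₀) := by linarith [min_le_right 2 (1 + 1 / (B * 2 ^ m₀))]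
    rw [lt_div_iff₀ (by positivity)] at hy2
    have h2 := hD.right_shrink_le x (h := d) hl m₀ (by
      calc 2 ^ m₀ * l ≤ 2 ^ m₀ * (B * (y - 1) * d) := by gcongr
        _ = (y - 1) * (B * 2 ^ m₀) * d := by ring
        _ ≤ 1 * d := by gcongr
        _ = d := one_mul d)
    have h3 : H * ρ ^ m₀ ≤ θ⁻¹ - 1 := by linarith
    calc D (x - d) x + D x (x + l) ≤ D (x - d) x + (θ⁻¹ - 1) * D (x - d) x := by
          gcongr; exact h2.trans (by gcongr)
      _ = θ⁻¹ * 1 * D (x - d) x := by ring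
      _ ≤ _ := by gcongr; exact one_le_pow₀ hy
  · rw [not_lt] at hyz
    obtain ⟨i, hi, hi'⟩ := exists_nat_pow_near hy hz1
    have hi0 : i ≠ 0 := by
      rintro rfl
      rw [zero_add, pow_one] at hi'
      linarith
    have hy2 : y - 1 ≤ 2 ^ (i + 1) := by
      have : z ^ (i + 1) ≤ 2 ^ (i + 1) := by gcongr; exact min_le_left _ _
      linarith
    have h2 := hD.right_dilate_le x hd.le hl (m₁ + 1 + i) (by
      calc l ≤ B * (y - 1) * d := hly
        _ ≤ 2 ^ m₁ * 2 ^ (i + 1) * d := by gcongr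
        _ = _ := by ring)
    have h3 : 1 + H * (1 + H) ^ (m₁ + 1 + i) ≤ y ^ A := by
      have hone : 1 ≤ (1 + H) ^ i := one_le_pow₀ (by linarith)
      have hC1 : 1 ≤ C := by
        rw [hC]; linarith [show 0 ≤ H * (1 + H) ^ (m₁ + 1) by positivity]
      calc 1 + H * (1 + H) ^ (m₁ + 1 + i) ≤ C * (1 + H) ^ i := by
            rw [hC, pow_add _ (m₁ + 1) i]
            nlinarith [show 0 ≤ H * (1 + H) ^ (m₁ + 1) by positivity]
        _ ≤ C ^ i * (1 + H) ^ i := by gcongr; exact le_self_pow₀ hC1 hi0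
        _ = (C * (1 + H)) ^ i := by rw [mul_pow]
        _ ≤ (z ^ A) ^ i := by gcongr
        _ = (z ^ i) ^ A := by rw [← pow_mul, ← pow_mul, mul_comm]
        _ ≤ y ^ A := by gcongr
    calc D (x - d) x + D x (x + l) ≤ (1 + H * (1 + H) ^ (m₁ + 1 + i)) * D (x - d) x := by linarith
      _ ≤ y ^ A * D (x - d) x := by gcongr
      _ = 1 * y ^ A * D (x - d) x := by ring
      _ ≤ _ := by gcongr

end IsDoublingSize

/-- The size of the image of `[x, y]` under a quasisymmetric map is a doubling interval function,
with constant `η 1`. -/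
theorem IsQuasisymmetric.exists_isDoublingSize {f : ℝ → ℝ} (hf : IsQuasisymmetric f) :
    ∃ H, IsDoublingSize (fun x y => |f y - f x|) H := by
  obtain ⟨hh, η, hη⟩ := hf
  have hinj : Function.Injective f := hh.bijective.1
  have hcomp : ∀ x h : ℝ, |f (x + h) - f x| ≤ max 1 (η 1 : ℝ) * |f (x - h) - f x| := by
    intro x h
    rcases eq_or_ne h 0 with rfl | h0
    · simp
    have hne : x ≠ x - h := fun he => h0 (by linarith)
    have h1 := hη (x + h) (x - h) x hne
    have e1 : nndist x (x + h) / nndist x (x - h) = 1 := by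
      have : nndist x (x - h) = nndist x (x + h) := by
        ext; simp
      rw [this, div_self]
      simpa [nndist_eq_zero] using h0
    have h2 : 0 < nndist (f x) (f (x - h)) := by
      rw [pos_iff_ne_zero, ne_eq, nndist_eq_zero]
      exact fun he => hne (hinj he)
    rw [e1, div_le_iff₀ h2] at h1
    have h3 : dist (f x) (f (x + h)) ≤ η 1 * dist (f x) (f (x - h)) := by exact_mod_cast h1
    rw [Real.dist_eq, Real.dist_eq, abs_sub_comm, abs_sub_comm (f x)] at h3
    exact h3.trans (by gcongr; exact le_max_right _ _)
  refine ⟨max 1 (η 1 : ℝ), le_max_left _ _, fun h => ?_, fun {x y z} hxy hyz => ?_, ?_, ?_⟩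
  · exact abs_pos.2 (sub_ne_zero.2 fun he => h.ne' (hinj he))
  · rcases hh.continuous.strictMono_of_inj hinj with hm | hm
    · have a1 := hm.monotone hxy
      have a2 := hm.monotone hyz
      rw [abs_of_nonneg (by linarith), abs_of_nonneg (by linarith), abs_of_nonneg (by linarith)]
      ring
    · have a1 := hm.antitone hxy
      have a2 := hm.antitone hyz
      rw [abs_of_nonpos (by linarith), abs_of_nonpos (by linarith), abs_of_nonpos (by linarith)]
      ring
  · intro x h _
    have := hcomp x h
    rwa [abs_sub_comm (f (x - h))] at this
  · intro x h _
    have := hcomp x (-h)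
    rw [sub_neg_eq_add, ← sub_eq_add_neg] at this
    rwa [abs_sub_comm]

/-! ### Words and hull trees -/

/-- The words obtained from `σ` by appending `m` letters, the letter in position `i` being taken
from `1, …, n i`. -/
def descendants (n : ℕ → ℕ) (σ : List ℕ) : ℕ → Finset (List ℕ)
  | 0 => {σ}
  | m + 1 => (descendants n σ m ×ˢ Finset.Icc 1 (n (σ.length + m + 1))).image
      fun p => p.1 ++ [p.2]

/-- The number of words of length `k`. -/
def wordCount (n : ℕ → ℕ) (k : ℕ) : ℕ := ∏ i ∈ Finset.range k, n (i + 1)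

section words

variable {n : ℕ → ℕ} {σ τ : List ℕ} {k m : ℕ}

theorem length_of_mem_words (h : σ ∈ words n k) : σ.length = k := by
  induction k generalizing σ with
  | zero => rw [words] at h; simp_all
  | succ k ih =>
    obtain ⟨τ, hτ, j, -, rfl⟩ := h
    simp [ih hτ]

theorem append_mem_words {j : ℕ} (h : σ ∈ words n k) (hj : j ∈ Finset.Icc 1 (n (k + 1))) :
    σ ++ [j] ∈ words n (k + 1) := ⟨σ, h, j, hj, rfl⟩

theorem mem_descendants_succ (h : σ ∈ words n k) : τ ∈ descendants n σ (m + 1) ↔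
    ∃ ρ ∈ descendants n σ m, ∃ j ∈ Finset.Icc 1 (n (k + m + 1)), τ = ρ ++ [j] := by
  rw [descendants, length_of_mem_words h]
  simp only [Finset.mem_image, Finset.mem_product, Prod.exists]
  constructor
  · rintro ⟨ρ, j, ⟨hρ, hj⟩, rfl⟩
    exact ⟨ρ, hρ, j, hj, rfl⟩
  · rintro ⟨ρ, hρ, j, hj, rfl⟩
    exact ⟨ρ, j, ⟨hρ, hj⟩, rfl⟩

theorem mem_words_of_mem_descendants (h : σ ∈ words n k) (hτ : τ ∈ descendants n σ m) :
    τ ∈ words n (k + m) := by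
  induction m generalizing τ with
  | zero => rw [descendants, Finset.mem_singleton] at hτ; rwa [hτ]
  | succ m ih =>
    obtain ⟨ρ, hρ, j, hj, rfl⟩ := (mem_descendants_succ h).1 hτ
    exact append_mem_words (ih hρ) hj

theorem prefix_of_mem_descendants (hτ : τ ∈ descendants n σ m) : σ <+: τ := by
  induction m generalizing τ with
  | zero => rw [descendants, Finset.mem_singleton] at hτ; rw [hτ]
  | succ m ih =>
    rw [descendants] at hτ
    obtain ⟨⟨ρ, j⟩, hρ, rfl⟩ := Finset.mem_image.1 hτ
    exact (ih (Finset.mem_product.1 hρ).1).trans (List.prefix_append _ _)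

theorem disjoint_descendants {σ' : List ℕ} {m' : ℕ} (h : σ ∈ words n k) (h' : σ' ∈ words n k)
    (hne : σ ≠ σ') : Disjoint (descendants n σ m) (descendants n σ' m') := by
  rw [Finset.disjoint_left]
  intro τ hτ hτ'
  have hl : σ.length = σ'.length := by rw [length_of_mem_words h, length_of_mem_words h']
  exact hne ((List.prefix_of_prefix_length_le (prefix_of_mem_descendants hτ)
    (prefix_of_mem_descendants hτ') hl.le).eq_of_length hl)

theorem exists_descendants_of_mem_words (hτ : τ ∈ words n (k + m)) :
    ∃ σ ∈ words n k, τ ∈ descendants n σ m := by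
  induction m generalizing τ with
  | zero => exact ⟨τ, hτ, by simp [descendants]⟩
  | succ m ih =>
    obtain ⟨ρ, hρ, j, hj, rfl⟩ := hτ
    obtain ⟨σ, hσ, hρσ⟩ := ih hρ
    exact ⟨σ, hσ, (mem_descendants_succ hσ).2 ⟨ρ, hρσ, j, hj, rfl⟩⟩

theorem mem_descendants_nil : τ ∈ descendants n [] k ↔ τ ∈ words n k := by
  constructor
  · intro h
    simpa using mem_words_of_mem_descendants (k := 0) rfl h
  · intro h
    rw [← zero_add k] at h
    obtain ⟨σ, hσ, hτ⟩ := exists_descendants_of_mem_words h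
    rw [words, mem_singleton_iff] at hσ
    rwa [hσ] at hτ

theorem sum_descendants_succ {M : Type*} [AddCommMonoid M] (h : σ ∈ words n k)
    (φ : List ℕ → M) :
    ∑ τ ∈ descendants n σ (m + 1), φ τ =
      ∑ τ ∈ descendants n σ m, ∑ j ∈ Finset.Icc 1 (n (k + m + 1)), φ (τ ++ [j]) := by
  rw [descendants, length_of_mem_words h, Finset.sum_image, Finset.sum_product]
  rintro ⟨ρ, j⟩ - ⟨ρ', j'⟩ - he
  obtain ⟨h1, h2⟩ := List.append_inj' he rfl
  simp_all

theorem wordCount_succ (n : ℕ → ℕ) (k : ℕ) : wordCount n (k + 1) = wordCount n k * n (k + 1) :=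
  Finset.prod_range_succ _ _

theorem card_descendants_mul (h : σ ∈ words n k) :
    (descendants n σ m).card * wordCount n k = wordCount n (k + m) := by
  induction m with
  | zero => simp [descendants]
  | succ m ih =>
    rw [Finset.card_eq_sum_ones, sum_descendants_succ h, ← add_assoc, wordCount_succ, ← ih]
    simp
    ring

theorem card_words : (descendants n [] k).card = wordCount n k := by
  simpa [wordCount] using card_descendants_mul (n := n) (k := 0) (m := k) (σ := []) rfl

theorem two_pow_le_wordCount (hn : ∀ k, 2 ≤ n (k + 1)) (k : ℕ) : 2 ^ k ≤ wordCount n k := by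
  induction k with
  | zero => simp [wordCount]
  | succ k ih =>
    rw [wordCount_succ, pow_succ]
    exact Nat.mul_le_mul ih (hn k)

end words

/-- A homogeneous tree of intervals `[u σ, u σ + d k]`, for `σ` a word of length `k`, in which the
outermost children of an interval share its endpoints, and in which the gaps `g (k + 1) j` between
the children of an interval of order `k` are within a factor `χ` of each other. The intervals are
the convex hulls of the parts of a homogeneous perfect set in its basic intervals. -/
structure HullTree (n : ℕ → ℕ) (χ : ℝ) (d : ℕ → ℝ) (g : ℕ → ℕ → ℝ) (u : List ℕ → ℝ) : Prop where
  two_le : ∀ k, 2 ≤ n (k + 1)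
  one_le : 1 ≤ χ
  d_pos : ∀ k, 0 < d k
  gap_nonneg : ∀ k j, 1 ≤ j → j < n (k + 1) → 0 ≤ g (k + 1) j
  gap_le : ∀ k j j', 1 ≤ j → j < n (k + 1) → 1 ≤ j' → j' < n (k + 1) →
    g (k + 1) j ≤ χ * g (k + 1) j'
  first : ∀ k, ∀ σ ∈ words n k, u (σ ++ [1]) = u σ
  step : ∀ k, ∀ σ ∈ words n k, ∀ j, 1 ≤ j → j < n (k + 1) →
    u (σ ++ [j + 1]) = u (σ ++ [j]) + d (k + 1) + g (k + 1) j
  last : ∀ k, ∀ σ ∈ words n k, u (σ ++ [n (k + 1)]) + d (k + 1) = u σ + d k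

namespace HullTree

variable {n : ℕ → ℕ} {χ : ℝ} {d : ℕ → ℝ} {g : ℕ → ℕ → ℝ} {u : List ℕ → ℝ} {k : ℕ} {σ : List ℕ}

theorem child_add_le (T : HullTree n χ d g u) (hσ : σ ∈ words n k) {i j : ℕ} (hi : 1 ≤ i)
    (hij : i < j) (hj : j ≤ n (k + 1)) :
    u (σ ++ [i]) + d (k + 1) + g (k + 1) i ≤ u (σ ++ [j]) := by
  induction j, hij using Nat.le_induction with
  | base => rw [T.step k σ hσ i hi (by omega)]
  | succ j hij ih =>
    rw [T.step k σ hσ j (by omega) (by omega)]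
    have := ih (by omega)
    linarith [T.d_pos (k + 1), T.gap_nonneg k j (by omega) (by omega)]

theorem child_mono (T : HullTree n χ d g u) (hσ : σ ∈ words n k) {i j : ℕ} (hi : 1 ≤ i)
    (hij : i ≤ j) (hj : j ≤ n (k + 1)) : u (σ ++ [i]) ≤ u (σ ++ [j]) := by
  rcases hij.eq_or_lt with rfl | h
  · exact le_rfl
  · linarith [T.child_add_le hσ hi h hj, T.d_pos (k + 1),
      T.gap_nonneg k i (by omega) (by omega)]

theorem le_child (T : HullTree n χ d g u) (hσ : σ ∈ words n k) {j : ℕ} (hj : 1 ≤ j)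
    (hjn : j ≤ n (k + 1)) : u σ ≤ u (σ ++ [j]) := by
  rw [← T.first k σ hσ]
  exact T.child_mono hσ le_rfl hj hjn

theorem child_le (T : HullTree n χ d g u) (hσ : σ ∈ words n k) {j : ℕ} (hj : 1 ≤ j)
    (hjn : j ≤ n (k + 1)) : u (σ ++ [j]) + d (k + 1) ≤ u σ + d k := by
  rw [← T.last k σ hσ]
  linarith [T.child_mono hσ hj hjn le_rfl]

theorem le_descendant (T : HullTree n χ d g u) (hσ : σ ∈ words n k) {m : ℕ} {τ : List ℕ}
    (hτ : τ ∈ descendants n σ m) : u σ ≤ u τ ∧ u τ + d (k + m) ≤ u σ + d k := by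
  induction m generalizing τ with
  | zero =>
    rw [descendants, Finset.mem_singleton] at hτ
    simp [hτ]
  | succ m ih =>
    obtain ⟨ρ, hρ, j, hj, rfl⟩ := (mem_descendants_succ hσ).1 hτ
    obtain ⟨h1, h2⟩ := ih hρ
    have hρw := mem_words_of_mem_descendants hσ hρ
    rw [Finset.mem_Icc] at hj
    exact ⟨h1.trans (T.le_child hρw hj.1 hj.2), (T.child_le hρw hj.1 hj.2).trans h2⟩

theorem separated (T : HullTree n χ d g u) {τ τ' : List ℕ} (hτ : τ ∈ words n k)
    (hτ' : τ' ∈ words n k) (hne : τ ≠ τ') : u τ + d k ≤ u τ' ∨ u τ' + d k ≤ u τ := by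
  induction k generalizing τ τ' with
  | zero => rw [words, mem_singleton_iff] at hτ hτ'; exact absurd (hτ.trans hτ'.symm) hne
  | succ k ih =>
    obtain ⟨σ, hσ, j, hj, rfl⟩ := hτ
    obtain ⟨σ', hσ', j', hj', rfl⟩ := hτ'
    rw [Finset.mem_Icc] at hj hj'
    by_cases hs : σ = σ'
    · subst hs
      rcases lt_trichotomy j j' with h | h | h
      · left
        linarith [T.child_add_le hσ hj.1 h hj'.2, T.gap_nonneg k j hj.1 (by omega)]
      · exact absurd (by rw [h]) hne
      · right
        linarith [T.child_add_le hσ hj'.1 h hj.2, T.gap_nonneg k j' hj'.1 (by omega)]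
    · have h1 := T.le_child hσ hj.1 hj.2
      have h2 := T.child_le hσ hj.1 hj.2
      have h3 := T.le_child hσ' hj'.1 hj'.2
      have h4 := T.child_le hσ' hj'.1 hj'.2
      rcases ih hσ hσ' hs with h | h
      · left; linarith
      · right; linarith

theorem exists_word (T : HullTree n χ d g u) (k : ℕ) : ∃ σ, σ ∈ words n k := by
  induction k with
  | zero => exact ⟨[], rfl⟩
  | succ k ih =>
    obtain ⟨σ, hσ⟩ := ih
    exact ⟨_, append_mem_words hσ (Finset.mem_Icc.2 ⟨le_rfl, by linarith [T.two_le k]⟩)⟩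

theorem sum_spacing (T : HullTree n χ d g u) (k : ℕ) :
    ∑ j ∈ Finset.Ico 1 (n (k + 1)), (d (k + 1) + g (k + 1) j) = d k - d (k + 1) := by
  obtain ⟨σ, hσ⟩ := T.exists_word k
  have h1 : ∑ j ∈ Finset.Ico 1 (n (k + 1)), (d (k + 1) + g (k + 1) j) =
      ∑ j ∈ Finset.Ico 1 (n (k + 1)), (u (σ ++ [j + 1]) - u (σ ++ [j])) := by
    refine Finset.sum_congr rfl fun j hj => ?_
    rw [Finset.mem_Ico] at hj
    rw [T.step k σ hσ j hj.1 hj.2]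
    ring
  rw [h1, Finset.sum_Ico_sub (fun j => u (σ ++ [j])) (by linarith [T.two_le k]), T.first k σ hσ]
  linarith [T.last k σ hσ]

theorem spacing_le (T : HullTree n χ d g u) {j j' : ℕ} (hj : 1 ≤ j) (hjn : j < n (k + 1))
    (hj' : 1 ≤ j') (hjn' : j' < n (k + 1)) :
    d (k + 1) + g (k + 1) j ≤ χ * (d (k + 1) + g (k + 1) j') := by
  have h1 := T.gap_le k j j' hj hjn hj' hjn'
  have h2 := le_mul_of_one_le_left (T.d_pos (k + 1)).le T.one_le
  linarith

/-- The distance between the left endpoints of adjacent children is of order at most `d k / n`. -/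
theorem mul_spacing_le (T : HullTree n χ d g u) {j : ℕ} (hj : 1 ≤ j) (hjn : j < n (k + 1)) :
    n (k + 1) * (d (k + 1) + g (k + 1) j) ≤ 2 * χ * d k := by
  have h1 : ∑ i ∈ Finset.Ico 1 (n (k + 1)), (d (k + 1) + g (k + 1) j) ≤
      ∑ i ∈ Finset.Ico 1 (n (k + 1)), χ * (d (k + 1) + g (k + 1) i) :=
    Finset.sum_le_sum fun i hi => by
      rw [Finset.mem_Ico] at hi
      exact T.spacing_le hj hjn hi.1 hi.2
  rw [← Finset.mul_sum, T.sum_spacing k, Finset.sum_const, Nat.card_Ico, nsmul_eq_mul,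
    Nat.cast_sub (by linarith [T.two_le k])] at h1
  have h2 : (2 : ℝ) ≤ n (k + 1) := by exact_mod_cast T.two_le k
  have h3 := T.d_pos (k + 1)
  have h4 := T.gap_nonneg k j hj hjn
  have h5 := T.one_le
  push_cast at h1
  nlinarith [mul_nonneg (sub_nonneg.2 h2) (add_nonneg h3.le h4),
    mul_pos (zero_lt_one.trans_le h5) h3]

/-- The gaps between the children are of order at most `1 / n` times their total length. -/
theorem mul_gap_le (T : HullTree n χ d g u) {j : ℕ} (hj : 1 ≤ j) (hjn : j < n (k + 1)) :
    n (k + 1) * g (k + 1) j ≤ 2 * χ * (d k - n (k + 1) * d (k + 1)) := by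
  have h1 : ∑ i ∈ Finset.Ico 1 (n (k + 1)), g (k + 1) j ≤
      ∑ i ∈ Finset.Ico 1 (n (k + 1)), χ * g (k + 1) i :=
    Finset.sum_le_sum fun i hi => by
      rw [Finset.mem_Ico] at hi
      exact T.gap_le k j i hj hjn hi.1 hi.2
  have h0 := T.sum_spacing k
  rw [Finset.sum_add_distrib] at h0
  simp only [Finset.sum_const, Nat.card_Ico, nsmul_eq_mul] at h0 h1
  rw [← Finset.mul_sum] at h1
  rw [Nat.cast_sub (by linarith [T.two_le k])] at h0 h1
  have h2 : (2 : ℝ) ≤ n (k + 1) := by exact_mod_cast T.two_le k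
  have h4 := T.gap_nonneg k j hj hjn
  have e : ∑ i ∈ Finset.Ico 1 (n (k + 1)), g (k + 1) i = d k - n (k + 1) * d (k + 1) := by
    push_cast at h0; linarith
  rw [e] at h1
  push_cast at h1
  nlinarith [mul_nonneg (sub_nonneg.2 h2) h4]

theorem mul_d_succ_le (T : HullTree n χ d g u) (k : ℕ) : n (k + 1) * d (k + 1) ≤ d k := by
  have h0 := T.mul_gap_le (k := k) (j := 1) le_rfl (by linarith [T.two_le k])
  have h1 := T.gap_nonneg k 1 le_rfl (by linarith [T.two_le k])
  have h2 : (0 : ℝ) ≤ n (k + 1) * g (k + 1) 1 := by positivity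
  have h3 := T.one_le
  by_contra! hlt
  nlinarith [mul_pos (show (0 : ℝ) < 2 * χ by linarith) (sub_pos.2 hlt)]

theorem d_anti (T : HullTree n χ d g u) : Antitone d :=
  antitone_nat_of_succ_le fun k => by
    have h2 : (2 : ℝ) ≤ n (k + 1) := by exact_mod_cast T.two_le k
    nlinarith [T.mul_d_succ_le k, T.d_pos (k + 1)]

theorem wordCount_mul_d_le (T : HullTree n χ d g u) (k : ℕ) : wordCount n k * d k ≤ d 0 := by
  induction k with
  | zero => simp [wordCount]
  | succ k ih =>
    rw [wordCount_succ]
    push_cast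
    calc (wordCount n k : ℝ) * n (k + 1) * d (k + 1) = wordCount n k * (n (k + 1) * d (k + 1)) := by
          ring
      _ ≤ wordCount n k * d k := by gcongr; exact T.mul_d_succ_le k
      _ ≤ d 0 := ih

theorem wordCount_pos (T : HullTree n χ d g u) (k : ℕ) : 0 < (wordCount n k : ℝ) := by
  have := two_pow_le_wordCount T.two_le k
  exact_mod_cast (Nat.pos_of_ne_zero (by positivity)).trans_le this

theorem two_pow_le_wordCount_real (T : HullTree n χ d g u) (k : ℕ) :
    (2 : ℝ) ^ k ≤ wordCount n k := by
  exact_mod_cast two_pow_le_wordCount T.two_le k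

theorem tendsto_d (T : HullTree n χ d g u) : Filter.Tendsto d Filter.atTop (nhds 0) := by
  refine squeeze_zero (fun k => (T.d_pos k).le) (g := fun k => d 0 * (1 / 2) ^ k) (fun k => ?_) ?_
  · have h1 := T.wordCount_mul_d_le k
    have h2 := T.two_pow_le_wordCount_real k
    rw [one_div, inv_pow, ← div_eq_mul_inv, le_div_iff₀ (by positivity), mul_comm]
    exact (mul_le_mul_of_nonneg_right h2 (T.d_pos k).le).trans h1
  · simpa using (tendsto_pow_atTop_nhds_zero_of_lt_one (r := (1 / 2 : ℝ)) (by norm_num)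
      (by norm_num)).const_mul (d 0)

end HullTree

/-! ### Total lengths of the hulls when the packing dimension is one -/

namespace HullTree

variable {n : ℕ → ℕ} {χ : ℝ} {d : ℕ → ℝ} {g : ℕ → ℕ → ℝ} {u : List ℕ → ℝ}

theorem abs_child_sub_le (T : HullTree n χ d g u) {k : ℕ} {σ : List ℕ} (hσ : σ ∈ words n k)
    {i m : ℕ} (hi : 1 ≤ i) (him : i + m ≤ n (k + 1)) :
    u (σ ++ [i + m]) - u (σ ++ [i]) ≤ m * (2 * χ * d k / n (k + 1)) := by
  induction m with
  | zero => simp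
  | succ m ih =>
    have h1 := ih (by omega)
    have h2 := T.mul_spacing_le (k := k) (j := i + m) (by omega) (by omega)
    have h3 := T.step k σ hσ (i + m) (by omega) (by omega)
    have hn : (0 : ℝ) < n (k + 1) := by
      have := T.two_le k
      exact_mod_cast (by omega : 0 < n (k + 1))
    rw [mul_comm, ← le_div_iff₀ hn] at h2
    rw [← add_assoc, h3]
    push_cast
    linarith

open Classical in
/-- A ball centred near a point of the tree contains many left endpoints of intervals of a fixed
large order `L`: if `k` is the order with `d (k + 1) ≤ r / 4 < d k`, then the ball contains at
least one interval of order `k + 1`, and at least of the order of `r * n (k + 1) / d k` of them. -/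
theorem exists_mul_wordCount_le_card (T : HullTree n χ d g u) {L K : ℕ} {x r : ℝ} {τ : List ℕ}
    (hτ : τ ∈ words n L) (hx : |x - u τ| ≤ r / 4) (hL : d L ≤ r / 4) (hK : r / 4 < d K) :
    ∃ k, K ≤ k ∧ max 1 (r * n (k + 1) / (8 * χ * d k)) * wordCount n L ≤
      wordCount n (k + 1) *
        ((descendants n [] L).filter fun τ => u τ ∈ Metric.closedBall x r).card := by
  have hχ := T.one_le
  -- the order of the ball
  have hex : ∃ k, d k ≤ r / 4 := ⟨L, hL⟩
  obtain ⟨k, hk⟩ : ∃ k, Nat.find hex = k + 1 := by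
    refine Nat.exists_eq_succ_of_ne_zero fun h0 => ?_
    have h1 := Nat.find_spec hex
    rw [h0] at h1
    linarith [T.d_anti (Nat.zero_le K)]
  have hk1 : d (k + 1) ≤ r / 4 := hk ▸ Nat.find_spec hex
  have hk0 : r / 4 < d k := not_le.1 (Nat.find_min hex (by omega))
  have hKk : K ≤ k := by
    by_contra! hlt
    linarith [T.d_anti (show k + 1 ≤ K by omega)]
  have hkL : k + 1 ≤ L := hk ▸ Nat.find_min' hex hL
  obtain ⟨m, rfl⟩ := Nat.exists_eq_add_of_le hkL
  obtain ⟨τ', hτ', hττ'⟩ := exists_descendants_of_mem_words hτ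
  obtain ⟨σ, hσ, j, hj, rfl⟩ := hτ'
  rw [Finset.mem_Icc] at hj
  have hdk := T.d_pos k
  have hr : 0 < r := by linarith [T.d_pos (k + 1)]
  have hn2 := T.two_le k
  have hn : (0 : ℝ) < n (k + 1) := by exact_mod_cast (by omega : 0 < n (k + 1))
  set w := r * n (k + 1) / (8 * χ * d k) with hw
  have hw0 : 0 ≤ w := by positivity
  have hwn : w ≤ n (k + 1) / 2 := by
    rw [hw, div_le_iff₀ (by positivity)]
    nlinarith [mul_pos hn (sub_pos.2 hk0), mul_nonneg (sub_nonneg.2 hχ) (mul_pos hn hdk).le]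
  have hfl : (⌊w⌋₊ : ℝ) ≤ w := Nat.floor_le hw0
  have hfl2 : 2 * ⌊w⌋₊ ≤ n (k + 1) := by
    have : (2 : ℝ) * ⌊w⌋₊ ≤ n (k + 1) := by linarith
    exact_mod_cast this
  -- a run of `⌊w⌋₊ + 1` consecutive children, one of which contains `u τ`
  obtain ⟨i₀, hi₀, hi₀n, hi₀j, hji₀⟩ : ∃ i₀, 1 ≤ i₀ ∧ i₀ + ⌊w⌋₊ ≤ n (k + 1) ∧ i₀ ≤ j ∧
      j ≤ i₀ + ⌊w⌋₊ := by
    by_cases hc : j + ⌊w⌋₊ ≤ n (k + 1)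
    · exact ⟨j, hj.1, hc, le_rfl, by omega⟩
    · exact ⟨j - ⌊w⌋₊, by omega, by omega, by omega, by omega⟩
  have hwS : ∀ q : ℕ, q ≤ ⌊w⌋₊ → (q : ℝ) * (2 * χ * d k / n (k + 1)) ≤ r / 4 := by
    intro q hq
    have hqw : (q : ℝ) ≤ w := (Nat.cast_le.2 hq).trans hfl
    calc (q : ℝ) * (2 * χ * d k / n (k + 1)) ≤ w * (2 * χ * d k / n (k + 1)) := by gcongr
      _ = r / 4 := by rw [hw]; field_simp; norm_num
  have hclose : ∀ i ∈ Finset.Icc i₀ (i₀ + ⌊w⌋₊), |u (σ ++ [i]) - u (σ ++ [j])| ≤ r / 4 := by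
    intro i hi
    rw [Finset.mem_Icc] at hi
    rcases le_total i j with h | h
    · obtain ⟨q, rfl⟩ := Nat.exists_eq_add_of_le h
      rw [abs_sub_comm, abs_of_nonneg (sub_nonneg.2 (T.child_mono hσ (by omega) h hj.2))]
      exact (T.abs_child_sub_le hσ (by omega) (by omega)).trans (hwS q (by omega))
    · obtain ⟨q, rfl⟩ := Nat.exists_eq_add_of_le h
      rw [abs_of_nonneg (sub_nonneg.2 (T.child_mono hσ (by omega) h (by omega)))]
      exact (T.abs_child_sub_le hσ (by omega) (by omega)).trans (hwS q (by omega))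
  have hchild : ∀ i ∈ Finset.Icc i₀ (i₀ + ⌊w⌋₊), σ ++ [i] ∈ words n (k + 1) := by
    intro i hi
    rw [Finset.mem_Icc] at hi
    exact append_mem_words hσ (Finset.mem_Icc.2 ⟨by omega, by omega⟩)
  have hsub : (Finset.Icc i₀ (i₀ + ⌊w⌋₊)).biUnion (fun i => descendants n (σ ++ [i]) m) ⊆
      (descendants n [] (k + 1 + m)).filter fun τ => u τ ∈ Metric.closedBall x r := by
    intro ρ hρ
    obtain ⟨i, hi, hρi⟩ := Finset.mem_biUnion.1 hρ
    refine Finset.mem_filter.2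
      ⟨mem_descendants_nil.2 (mem_words_of_mem_descendants (hchild i hi) hρi), ?_⟩
    have h1 := T.le_descendant (hchild i hi) hρi
    have h2 := T.le_descendant (hchild j (Finset.mem_Icc.2 ⟨hi₀j, hji₀⟩)) hττ'
    have h3 := abs_le.1 (hclose i hi)
    have h4 := abs_le.1 hx
    have h5 := T.d_pos (k + 1 + m)
    rw [Metric.mem_closedBall, Real.dist_eq, abs_le]
    constructor <;> linarith
  have hcard := Finset.card_le_card hsub
  rw [Finset.card_biUnion] at hcard
  swap
  · intro i hi i' hi' hne
    exact disjoint_descendants (hchild i hi) (hchild i' hi') (by simpa using hne)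
  have hcard2 : (⌊w⌋₊ + 1) * wordCount n (k + 1 + m) ≤ wordCount n (k + 1) *
      ((descendants n [] (k + 1 + m)).filter fun τ => u τ ∈ Metric.closedBall x r).card := by
    calc (⌊w⌋₊ + 1) * wordCount n (k + 1 + m)
        = ∑ i ∈ Finset.Icc i₀ (i₀ + ⌊w⌋₊), wordCount n (k + 1 + m) := by
          simp; left; omega
      _ = ∑ i ∈ Finset.Icc i₀ (i₀ + ⌊w⌋₊),
            wordCount n (k + 1) * (descendants n (σ ++ [i]) m).card :=
          Finset.sum_congr rfl fun i hi => by
            rw [mul_comm (wordCount n (k + 1)), card_descendants_mul (hchild i hi)]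
      _ = wordCount n (k + 1) *
            ∑ i ∈ Finset.Icc i₀ (i₀ + ⌊w⌋₊), (descendants n (σ ++ [i]) m).card :=
          (Finset.mul_sum _ _ _).symm
      _ ≤ _ := Nat.mul_le_mul_left _ hcard
  refine ⟨k, hKk, ?_⟩
  have hcard3 : ((⌊w⌋₊ : ℝ) + 1) * wordCount n (k + 1 + m) ≤ wordCount n (k + 1) *
      (((descendants n [] (k + 1 + m)).filter fun τ => u τ ∈ Metric.closedBall x r).card : ℝ) := by
    exact_mod_cast hcard2
  refine le_trans ?_ hcard3
  gcongr
  exact max_le (by linarith [Nat.cast_nonneg (α := ℝ) ⌊w⌋₊]) (Nat.lt_floor_add_one w).le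

/-- If the total lengths `wordCount n k * d k` are eventually at most the power `-ε` of
`wordCount n (k + 1)`, then for `1 / (1 + ε) ≤ s ≤ 1` the uniform mass distribution gives every small
ball of radius `r` centred in `E` a mass of order at least `r ^ s`, so that the `s`-dimensional packing
measure is finite. -/
theorem packingMeasure_ne_top (T : HullTree n χ d g u) {E : Set ℝ}
    (hE : ∀ r > 0, ∃ L₀, ∀ L ≥ L₀, ∀ x ∈ E, ∃ τ ∈ words n L, |x - u τ| ≤ r)
    {ε : ℝ} {K : ℕ} (hM : ∀ k ≥ K, wordCount n k * d k ≤ (wordCount n (k + 1) : ℝ) ^ (-ε))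
    {s : ℝ≥0} (hs1 : s ≤ 1) (hs : 1 ≤ s * (1 + ε)) : packingMeasure s E ≠ ∞ := by
  classical
  have hχ := T.one_le
  refine packingMeasure_ne_top_of_packingSup_le (T.d_pos K) (C := (16 * χ) ^ (s : ℝ))
    fun t ht => ?_
  -- an order `L` that is large for all balls of the packing
  obtain ⟨L, hL⟩ : ∃ L, ∀ p ∈ t, d L ≤ p.2 / 4 ∧ ∃ τ ∈ words n L, |p.1 - u τ| ≤ p.2 / 4 := by
    have : ∀ᶠ L in Filter.atTop, ∀ p ∈ t, d L ≤ p.2 / 4 ∧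
        ∃ τ ∈ words n L, |p.1 - u τ| ≤ p.2 / 4 := by
      rw [Filter.eventually_all_finset]
      intro p hp
      have hr : 0 < p.2 / 4 := by linarith [(ht.1 p hp).2.1]
      obtain ⟨L₀, hL₀⟩ := hE _ hr
      filter_upwards [T.tendsto_d.eventually_le_const hr, Filter.eventually_ge_atTop L₀]
        with L h1 h2 using ⟨h1, hL₀ L h2 _ (ht.1 p hp).1⟩
    exact this.exists
  set c : ℝ × ℝ → ℕ := fun p =>
    ((descendants n [] L).filter fun τ => u τ ∈ Metric.closedBall p.1 p.2).card with hc
  have hNL := T.wordCount_pos L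
  have hball : ∀ p ∈ t, (2 * p.2) ^ (s : ℝ) * wordCount n L ≤ (16 * χ) ^ (s : ℝ) * c p := by
    intro p hp
    obtain ⟨hpE, hr, hrd⟩ := ht.1 p hp
    obtain ⟨hdL, τ, hτ, hxτ⟩ := hL p hp
    obtain ⟨k, hk, hcard⟩ := T.exists_mul_wordCount_le_card (K := K) hτ hxτ hdL (by linarith)
    have hdk := T.d_pos k
    have hNk := T.wordCount_pos k
    have hNk1 := T.wordCount_pos (k + 1)
    have hn : (0 : ℝ) < n (k + 1) := by
      have := T.two_le k
      exact_mod_cast (by omega : 0 < n (k + 1))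
    set w := p.2 * n (k + 1) / (8 * χ * d k) with hw
    have hw0 : 0 < w := by positivity
    have h1 : w ^ (s : ℝ) ≤ max 1 w := by
      rcases le_total w 1 with h | h
      · exact (Real.rpow_le_one hw0.le h s.2).trans (le_max_left _ _)
      · refine le_trans ?_ (le_max_right _ _)
        calc w ^ (s : ℝ) ≤ w ^ (1 : ℝ) :=
              Real.rpow_le_rpow_of_exponent_le h (by exact_mod_cast hs1)
          _ = w := Real.rpow_one w
    have h2 : (wordCount n (k + 1) : ℝ) ≤
        ((wordCount n (k + 1) : ℝ) / (wordCount n k * d k)) ^ (s : ℝ) := by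
      have hone : (1 : ℝ) ≤ wordCount n (k + 1) :=
        (one_le_pow₀ (by norm_num)).trans (T.two_pow_le_wordCount_real (k + 1))
      calc (wordCount n (k + 1) : ℝ) = (wordCount n (k + 1) : ℝ) ^ (1 : ℝ) := (Real.rpow_one _).symm
        _ ≤ (wordCount n (k + 1) : ℝ) ^ ((1 + ε) * s) :=
            Real.rpow_le_rpow_of_exponent_le hone (by linarith)
        _ = ((wordCount n (k + 1) : ℝ) / (wordCount n (k + 1) : ℝ) ^ (-ε)) ^ (s : ℝ) := by
            rw [Real.rpow_mul hNk1.le, Real.rpow_add hNk1, Real.rpow_one, Real.rpow_neg hNk1.le,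
              div_inv_eq_mul]
        _ ≤ _ := by
            gcongr
            exact hM k hk
    have h3 : w = p.2 / (8 * χ) * (wordCount n (k + 1) / (wordCount n k * d k)) := by
      rw [hw, wordCount_succ]
      push_cast
      field_simp
    have h4 : (p.2 / (8 * χ)) ^ (s : ℝ) * wordCount n (k + 1) ≤ max 1 w := by
      refine le_trans ?_ h1
      rw [h3, Real.mul_rpow (by positivity) (by positivity)]
      gcongr
    have h5 : (p.2 / (8 * χ)) ^ (s : ℝ) * wordCount n L ≤ c p := by
      have := (mul_le_mul_of_nonneg_right h4 hNL.le).trans hcard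
      refine le_of_mul_le_mul_left ?_ hNk1
      linarith
    have h6 : 2 * p.2 = 16 * χ * (p.2 / (8 * χ)) := by field_simp; norm_num
    rw [h6, Real.mul_rpow (by positivity) (by positivity), mul_assoc]
    gcongr
  have hsum : ∑ p ∈ t, c p ≤ wordCount n L := by
    rw [← card_words, hc, ← Finset.card_biUnion]
    · exact Finset.card_le_card (Finset.biUnion_subset.2 fun p _ => Finset.filter_subset _ _)
    · intro p hp q hq hpq
      rw [Function.onFun, Finset.disjoint_left]
      intro τ h1 h2
      exact Set.disjoint_left.1 (ht.2 hp hq hpq) (Finset.mem_filter.1 h1).2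
        (Finset.mem_filter.1 h2).2
  refine le_of_mul_le_mul_right ?_ hNL
  calc (∑ p ∈ t, (2 * p.2) ^ (s : ℝ)) * wordCount n L
      ≤ ∑ p ∈ t, (16 * χ) ^ (s : ℝ) * c p := by
        rw [Finset.sum_mul]; exact Finset.sum_le_sum hball
    _ = (16 * χ) ^ (s : ℝ) * ((∑ p ∈ t, c p : ℕ) : ℝ) := by push_cast; rw [Finset.mul_sum]
    _ ≤ (16 * χ) ^ (s : ℝ) * wordCount n L := by
        gcongr

/-- If the packing dimension is `1`, then infinitely often the total length `wordCount n k * d k` is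
larger than any given negative power of `wordCount n (k + 1)`. -/
theorem exists_rpow_lt (T : HullTree n χ d g u) {E : Set ℝ} {a b : ℝ} (hab : E ⊆ Icc a b)
    (hE : ∀ r > 0, ∃ L₀, ∀ L ≥ L₀, ∀ x ∈ E, ∃ τ ∈ words n L, |x - u τ| ≤ r)
    (hdim : packingDim E = 1) {ε : ℝ} (hε : 0 < ε) (K : ℕ) :
    ∃ k ≥ K, (wordCount n (k + 1) : ℝ) ^ (-ε) < wordCount n k * d k := by
  by_contra! hcon
  have hle : packingDim E ≤ ((1 + ε).toNNReal⁻¹ : ℝ≥0) := by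
    refine packingDim_le_of_forall fun s hs => ?_
    rcases le_total s 1 with h | h
    · refine T.packingMeasure_ne_top hE hcon h ?_
      have h1 : ((1 + ε).toNNReal⁻¹ : ℝ) < s := by exact_mod_cast hs
      rw [Real.coe_toNNReal _ (by linarith), inv_lt_iff_one_lt_mul₀ (by linarith)] at h1
      linarith
    · exact packingMeasure_ne_top_of_one_le h hab
  rw [hdim] at hle
  have h1 : (1 : ℝ≥0) ≤ (1 + ε).toNNReal⁻¹ := by exact_mod_cast hle
  have h2 : (1 : ℝ) ≤ (1 + ε)⁻¹ := by
    have := NNReal.coe_le_coe.2 h1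
    rwa [NNReal.coe_inv, Real.coe_toNNReal _ (by linarith), NNReal.coe_one] at this
  exact absurd h2 (not_le.2 (inv_lt_one_of_one_lt₀ (by linarith)))

end HullTree

/-! ### Packings of the image -/

namespace HullTree

variable {n : ℕ → ℕ} {χ : ℝ} {d : ℕ → ℝ} {g : ℕ → ℕ → ℝ} {u : List ℕ → ℝ}
  {D : ℝ → ℝ → ℝ} {H : ℝ}

/-- Passing from an interval to its children, the proportion of size that is lost to the gaps is
controlled by the proportion of length: if the children keep the proportion `t` of the length, then
they keep at least the proportion `θ * t ^ A` of the size. The factor `θ` may be taken arbitrarily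
close to `1`, which absorbs the gaps that are too short to matter. -/
theorem exists_size_children_ge (T : HullTree n χ d g u) (hD : IsDoublingSize D H) {θ : ℝ}
    (hθ0 : 0 < θ) (hθ : θ < 1) : ∃ A : ℕ, ∀ k, ∀ σ ∈ words n k,
      θ * (n (k + 1) * d (k + 1) / d k) ^ A * D (u σ) (u σ + d k) ≤
        ∑ j ∈ Finset.Icc 1 (n (k + 1)), D (u (σ ++ [j])) (u (σ ++ [j]) + d (k + 1)) := by
  have hχ := T.one_le
  obtain ⟨A, hA⟩ := hD.exists_gap_le hθ0 hθ (B := 2 * χ) (by linarith)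
  refine ⟨A, fun k σ hσ => ?_⟩
  have hd := T.d_pos (k + 1)
  have hdk := T.d_pos k
  have hn2 := T.two_le k
  have hn : (0 : ℝ) < n (k + 1) := by exact_mod_cast (by omega : 0 < n (k + 1))
  set y := d k / (n (k + 1) * d (k + 1)) with hy
  have hy1 : 1 ≤ y := by
    rw [hy, one_le_div (by positivity)]
    exact T.mul_d_succ_le k
  set c := θ⁻¹ * y ^ A with hc
  have hc1 : 1 ≤ c := one_le_mul_of_one_le_of_one_le ((one_le_inv₀ hθ0).2 hθ.le) (one_le_pow₀ hy1)
  have hstep : ∀ j, 1 ≤ j → j < n (k + 1) →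
      D (u (σ ++ [j])) (u (σ ++ [j]) + d (k + 1)) +
        D (u (σ ++ [j]) + d (k + 1)) (u (σ ++ [j + 1])) ≤
      c * D (u (σ ++ [j])) (u (σ ++ [j]) + d (k + 1)) := by
    intro j hj hjn
    have h1 := hA (u (σ ++ [j]) + d (k + 1)) (d (k + 1)) (g (k + 1) j) y hd
      (T.gap_nonneg k j hj hjn) hy1 (by
        have h2 := T.mul_gap_le (k := k) hj hjn
        rw [mul_comm, ← le_div_iff₀ hn] at h2
        refine h2.trans (le_of_eq ?_)
        rw [hy]
        field_simp)
    rwa [add_sub_cancel_right, ← T.step k σ hσ j hj hjn] at h1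
  have hind : ∀ m, 1 ≤ m → m ≤ n (k + 1) →
      D (u (σ ++ [1])) (u (σ ++ [m]) + d (k + 1)) ≤
        c * ∑ j ∈ Finset.Ico 1 m, D (u (σ ++ [j])) (u (σ ++ [j]) + d (k + 1)) +
          D (u (σ ++ [m])) (u (σ ++ [m]) + d (k + 1)) := by
    intro m hm
    induction m, hm using Nat.le_induction with
    | base => simp
    | succ m hm ih =>
      intro hmn
      have h1 := ih (by omega)
      have h2 := hstep m hm (by omega)
      have h3 := T.step k σ hσ m hm (by omega)
      have h4 := T.gap_nonneg k m hm (by omega)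
      have h5 := T.child_mono hσ le_rfl hm (by omega)
      have h6 := hD.add (x := u (σ ++ [1])) (y := u (σ ++ [m]) + d (k + 1))
        (z := u (σ ++ [m + 1])) (by linarith) (by linarith)
      have h7 := hD.add (x := u (σ ++ [1])) (y := u (σ ++ [m + 1]))
        (z := u (σ ++ [m + 1]) + d (k + 1)) (by linarith) (by linarith)
      rw [Finset.sum_Ico_succ_top hm, mul_add]
      linarith
  have hfin := hind (n (k + 1)) (by omega) le_rfl
  have hlast : 0 ≤ D (u (σ ++ [n (k + 1)])) (u (σ ++ [n (k + 1)]) + d (k + 1)) :=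
    hD.nonneg (by linarith)
  have hIcc : Finset.Icc 1 (n (k + 1)) = Finset.Ico 1 (n (k + 1) + 1) := by ext; simp
  have htot : D (u σ) (u σ + d k) ≤
      c * ∑ j ∈ Finset.Icc 1 (n (k + 1)), D (u (σ ++ [j])) (u (σ ++ [j]) + d (k + 1)) := by
    rw [← T.last k σ hσ, ← T.first k σ hσ, hIcc, Finset.sum_Ico_succ_top (by omega), mul_add]
    linarith [le_mul_of_one_le_left hlast hc1]
  have hinv : θ * (n (k + 1) * d (k + 1) / d k) ^ A = c⁻¹ := by
    rw [hc, hy, mul_inv, inv_inv, ← inv_pow, inv_div]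
  rw [hinv, inv_mul_le_iff₀ (by linarith)]
  exact htot

theorem exists_size_descendants_ge (T : HullTree n χ d g u) (hD : IsDoublingSize D H) {θ : ℝ}
    (hθ0 : 0 < θ) (hθ : θ < 1) : ∃ A : ℕ, ∀ k, ∀ σ ∈ words n k, ∀ m,
      θ ^ m * (wordCount n (k + m) * d (k + m) / (wordCount n k * d k)) ^ A *
          D (u σ) (u σ + d k) ≤
        ∑ τ ∈ descendants n σ m, D (u τ) (u τ + d (k + m)) := by
  obtain ⟨A, hA⟩ := T.exists_size_children_ge hD hθ0 hθ
  refine ⟨A, fun k σ hσ m => ?_⟩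
  have hNk := T.wordCount_pos k
  have hdk := T.d_pos k
  induction m with
  | zero =>
    simp [descendants, div_self (mul_pos hNk hdk).ne']
  | succ m ih =>
    have hN := T.wordCount_pos (k + m)
    have hd := T.d_pos (k + m)
    have hd' := T.d_pos (k + m + 1)
    rw [sum_descendants_succ hσ]
    set t := (n (k + m + 1) * d (k + m + 1) / d (k + m)) with ht
    have ht0 : 0 ≤ t := by positivity
    calc θ ^ (m + 1) * (wordCount n (k + (m + 1)) * d (k + (m + 1)) / (wordCount n k * d k)) ^ A *
          D (u σ) (u σ + d k)
        = θ * t ^ A * (θ ^ m * (wordCount n (k + m) * d (k + m) / (wordCount n k * d k)) ^ A *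
          D (u σ) (u σ + d k)) := by
          have : wordCount n (k + (m + 1)) * d (k + (m + 1)) / (wordCount n k * d k) =
              t * (wordCount n (k + m) * d (k + m) / (wordCount n k * d k)) := by
            rw [ht, ← add_assoc, wordCount_succ]
            push_cast
            field_simp
          rw [this, mul_pow]
          ring
      _ ≤ θ * t ^ A * ∑ τ ∈ descendants n σ m, D (u τ) (u τ + d (k + m)) := by gcongr
      _ = ∑ τ ∈ descendants n σ m, θ * t ^ A * D (u τ) (u τ + d (k + m)) := Finset.mul_sum _ _ _
      _ ≤ _ := Finset.sum_le_sum fun τ hτ => hA _ τ (mem_words_of_mem_descendants hσ hτ)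

theorem size_le_mul_sum_spacing (T : HullTree n χ d g u) (hD : IsDoublingSize D H) {k : ℕ}
    {σ : List ℕ} (hσ : σ ∈ words n k) :
    D (u σ) (u σ + d k) ≤
      (1 + H) * ∑ j ∈ Finset.Ico 1 (n (k + 1)), D (u (σ ++ [j])) (u (σ ++ [j + 1])) := by
  have hH := hD.one_le
  have hn2 := T.two_le k
  have hd := T.d_pos (k + 1)
  have hsum : ∀ m, 1 ≤ m → m ≤ n (k + 1) → D (u (σ ++ [1])) (u (σ ++ [m])) =
      ∑ j ∈ Finset.Ico 1 m, D (u (σ ++ [j])) (u (σ ++ [j + 1])) := by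
    intro m hm
    induction m, hm using Nat.le_induction with
    | base => simp [hD.self]
    | succ m hm ih =>
      intro hmn
      rw [Finset.sum_Ico_succ_top hm, ← ih (by omega)]
      exact hD.add (T.child_mono hσ le_rfl hm (by omega))
        (T.child_mono hσ hm (by omega) hmn)
  rw [← hsum _ (by omega) le_rfl]
  obtain ⟨m, hm⟩ : ∃ m, n (k + 1) = m + 1 := ⟨n (k + 1) - 1, by omega⟩
  have h1 := T.last k σ hσ
  have h2 := T.step k σ hσ m (by omega) (by omega)
  have h3 := T.gap_nonneg k m (by omega) (by omega)
  have h4 := hD.right_le (u (σ ++ [m + 1])) (h := d (k + 1) + g (k + 1) m) (by linarith)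
  have h5 := T.child_mono hσ (i := 1) (j := m) le_rfl (by omega) (by omega)
  rw [show u (σ ++ [m + 1]) - (d (k + 1) + g (k + 1) m) = u (σ ++ [m]) by linarith] at h4
  have h6 : D (u (σ ++ [m])) (u (σ ++ [m + 1])) ≤ D (u (σ ++ [1])) (u (σ ++ [m + 1])) :=
    hD.mono h5 (by linarith) le_rfl
  have h7 : D (u (σ ++ [m + 1])) (u (σ ++ [m + 1]) + d (k + 1)) ≤
      D (u (σ ++ [m + 1])) (u (σ ++ [m + 1]) + (d (k + 1) + g (k + 1) m)) :=
    hD.mono le_rfl (by linarith) (by linarith)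
  rw [hm] at h1 ⊢
  rw [← h1, ← T.first k σ hσ, hD.add (y := u (σ ++ [m + 1])) (by linarith) (by linarith)]
  have h8 : H * D (u (σ ++ [m])) (u (σ ++ [m + 1])) ≤ H * D (u (σ ++ [1])) (u (σ ++ [m + 1])) := by
    gcongr
  linarith

/-- The left endpoints of the intervals of order `k + 1`, the last child of each interval being left
out, are the centres of disjoint balls in the size metric, the radius at `u (σ ++ [j])` being a fixed
multiple of the size of `[u (σ ++ [j]), u (σ ++ [j + 1])]`. -/
theorem exists_separated_radius (T : HullTree n χ d g u) (hD : IsDoublingSize D H) :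
    ∃ κ : ℝ, 0 < κ ∧ 2 * κ ≤ 1 ∧ ∀ k, ∀ σ ∈ words n k, ∀ σ' ∈ words n k, ∀ j j', 1 ≤ j →
      j < n (k + 1) → 1 ≤ j' → j' < n (k + 1) →
      u (σ ++ [j + 1]) ≤ u (σ' ++ [j']) →
      κ * D (u (σ ++ [j])) (u (σ ++ [j + 1])) + κ * D (u (σ' ++ [j'])) (u (σ' ++ [j' + 1])) <
        D (u (σ ++ [j])) (u (σ' ++ [j'])) := by
  have hH := hD.one_le
  obtain ⟨m, hm⟩ := pow_unbounded_of_one_lt χ (by norm_num : (1 : ℝ) < 2)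
  set C := H * (1 + H) ^ m with hC
  have hC0 : 0 < C := by positivity
  -- both spacings are controlled by the distance, with constants `1` and `C`
  refine ⟨1 / (2 + C), by positivity, by
    rw [mul_one_div, div_le_one (by positivity)]; linarith, ?_⟩
  intro k σ hσ σ' hσ' j j' hj hjn hj' hjn' hle
  have h1 := T.step k σ hσ j hj hjn
  have h2 := T.step k σ' hσ' j' hj' hjn'
  have h3 := T.spacing_le hj' hjn' hj hjn
  have hd := T.d_pos (k + 1)
  have hg := T.gap_nonneg k j hj hjn
  have hg' := T.gap_nonneg k j' hj' hjn'
  have h4 := hD.right_dilate_le (u (σ' ++ [j'])) (h := d (k + 1) + g (k + 1) j)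
    (l := d (k + 1) + g (k + 1) j') (by linarith) (by linarith) m
    (h3.trans (by gcongr))
  rw [← add_assoc, ← h2] at h4
  have h5 : D (u (σ' ++ [j']) - (d (k + 1) + g (k + 1) j)) (u (σ' ++ [j'])) ≤
      D (u (σ ++ [j])) (u (σ' ++ [j'])) := hD.mono (by linarith) (by linarith) le_rfl
  have h6 : D (u (σ ++ [j])) (u (σ ++ [j + 1])) ≤ D (u (σ ++ [j])) (u (σ' ++ [j'])) :=
    hD.mono le_rfl (by linarith) hle
  have h7 : 0 < D (u (σ ++ [j])) (u (σ' ++ [j'])) := hD.pos (by linarith)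
  have h8 : D (u (σ' ++ [j'])) (u (σ' ++ [j' + 1])) ≤ C * D (u (σ ++ [j])) (u (σ' ++ [j'])) :=
    h4.trans (by gcongr)
  rw [← mul_add, one_div_mul_eq_div, div_lt_iff₀ (by positivity)]
  linarith

/-- Two left endpoints of intervals of order `k + 1` are separated by the spacing to the right of
the smaller one. -/
theorem next_le_or_next_le (T : HullTree n χ d g u) {k : ℕ} {σ σ' : List ℕ} (hσ : σ ∈ words n k)
    (hσ' : σ' ∈ words n k) {j j' : ℕ} (hj : 1 ≤ j) (hjn : j < n (k + 1)) (hj' : 1 ≤ j')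
    (hjn' : j' < n (k + 1)) (hne : (σ, j) ≠ (σ', j')) :
    u (σ ++ [j + 1]) ≤ u (σ' ++ [j']) ∨ u (σ' ++ [j' + 1]) ≤ u (σ ++ [j]) := by
  by_cases hs : σ = σ'
  · subst hs
    rcases lt_trichotomy j j' with h | h | h
    · exact Or.inl (T.child_mono hσ (by omega) h (by omega))
    · exact absurd (by rw [h]) hne
    · exact Or.inr (T.child_mono hσ (by omega) h (by omega))
  · have hd := T.d_pos (k + 1)
    have h1 := T.le_child hσ hj hjn.le
    have h2 := T.child_le hσ (j := j + 1) (by omega) hjn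
    have h3 := T.le_child hσ' hj' hjn'.le
    have h4 := T.child_le hσ' (j := j' + 1) (by omega) hjn'
    rcases T.separated hσ hσ' hs with h | h
    · left; linarith
    · right; linarith

/-- A lower bound for the packing sums of the image of the tree under `f`, from the packing with the
points `f (u (σ ++ [j]))`, where `w` bounds the sizes of the spacings of order `k + 1`. -/
theorem exists_le_packingSup (T : HullTree n χ d g u) {f : ℝ → ℝ}
    (hD : IsDoublingSize (fun x y => |f y - f x|) H) {s : ℝ≥0} (hs : s ≤ 1) :
    ∃ c : ℝ, 0 < c ∧ ∀ k m, ∀ σ₀ ∈ words n k, ∀ A : Set ℝ,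
      (∀ τ ∈ descendants n σ₀ (m + 1), f (u τ) ∈ A) → ∀ w δ : ℝ, w ≤ δ →
      (∀ σ ∈ words n (k + m), ∀ j, 1 ≤ j → j < n (k + m + 1) →
        |f (u (σ ++ [j + 1])) - f (u (σ ++ [j]))| ≤ w) →
      ENNReal.ofReal (c * w ^ ((s : ℝ) - 1) *
        ∑ σ ∈ descendants n σ₀ m, |f (u σ + d (k + m)) - f (u σ)|) ≤ packingSup s δ A := by
  classical
  have hH := hD.one_le
  obtain ⟨κ, hκ, hκ1, hsep⟩ := T.exists_separated_radius hD
  refine ⟨2 * κ / (1 + H), by positivity, fun k m σ₀ hσ₀ A hA w δ hwδ hw => ?_⟩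
  set S := descendants n σ₀ m ×ˢ Finset.Ico 1 (n (k + m + 1)) with hS
  have hmem : ∀ p ∈ S, p.1 ∈ words n (k + m) ∧ 1 ≤ p.2 ∧ p.2 < n (k + m + 1) := by
    intro p hp
    obtain ⟨h1, h2⟩ := Finset.mem_product.1 hp
    rw [Finset.mem_Ico] at h2
    exact ⟨mem_words_of_mem_descendants hσ₀ h1, h2⟩
  set L : List ℕ × ℕ → ℝ := fun p => |f (u (p.1 ++ [p.2 + 1])) - f (u (p.1 ++ [p.2]))| with hL
  have hLpos : ∀ p ∈ S, 0 < L p := by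
    intro p hp
    obtain ⟨h1, h2, h3⟩ := hmem p hp
    refine hD.pos ?_
    linarith [T.step _ _ h1 _ h2 h3, T.d_pos (k + m + 1), T.gap_nonneg _ _ h2 h3]
  have hLw : ∀ p ∈ S, L p ≤ w := fun p hp =>
    hw p.1 (hmem p hp).1 p.2 (hmem p hp).2.1 (hmem p hp).2.2
  have hpack := sum_le_packingSup S (fun p => f (u (p.1 ++ [p.2]))) (fun p => κ * L p) s δ A
    (fun p hp => hA _ ((mem_descendants_succ hσ₀).2 ⟨p.1, (Finset.mem_product.1 hp).1, p.2,
      Finset.mem_Icc.2 ⟨(hmem p hp).2.1, (hmem p hp).2.2.le⟩, rfl⟩))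
    (fun p hp => mul_pos hκ (hLpos p hp))
    (fun p hp => by
      have h1 := hLw p hp
      have h2 := hLpos p hp
      nlinarith)
    (fun p hp q hq hpq => by
      obtain ⟨h1, h2, h3⟩ := hmem p hp
      obtain ⟨h1', h2', h3'⟩ := hmem q hq
      rcases T.next_le_or_next_le h1 h1' h2 h3 h2' h3' hpq with h | h
      · rw [abs_sub_comm]
        exact hsep _ _ h1 _ h1' _ _ h2 h3 h2' h3' h
      · rw [add_comm]
        exact hsep _ _ h1' _ h1 _ _ h2' h3' h2 h3 h)
  refine le_trans ?_ hpack
  have hterm : ∀ p ∈ S, w ^ ((s : ℝ) - 1) * (2 * κ * L p) ≤ (2 * (κ * L p)) ^ (s : ℝ) := by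
    intro p hp
    have h1 := hLpos p hp
    have h2 := hLw p hp
    have h3 : 0 < 2 * κ * L p := by positivity
    rw [← mul_assoc 2 κ]
    calc w ^ ((s : ℝ) - 1) * (2 * κ * L p) ≤ (2 * κ * L p) ^ ((s : ℝ) - 1) * (2 * κ * L p) := by
          gcongr ?_ * _
          exact Real.rpow_le_rpow_of_nonpos h3 (by nlinarith)
            (sub_nonpos.2 (by exact_mod_cast hs))
      _ = (2 * κ * L p) ^ (s : ℝ) := by
          rw [Real.rpow_sub_one h3.ne', div_mul_cancel₀ _ h3.ne']
  calc ENNReal.ofReal (2 * κ / (1 + H) * w ^ ((s : ℝ) - 1) *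
        ∑ σ ∈ descendants n σ₀ m, |f (u σ + d (k + m)) - f (u σ)|)
      ≤ ENNReal.ofReal (∑ p ∈ S, (2 * (κ * L p)) ^ (s : ℝ)) := by
        refine ENNReal.ofReal_le_ofReal ?_
        refine le_trans ?_ (Finset.sum_le_sum hterm)
        rw [← Finset.mul_sum, ← Finset.mul_sum, hS, Finset.sum_product]
        have hsum : ∑ σ ∈ descendants n σ₀ m, |f (u σ + d (k + m)) - f (u σ)| ≤
            (1 + H) * ∑ σ ∈ descendants n σ₀ m,
              ∑ j ∈ Finset.Ico 1 (n (k + m + 1)), L (σ, j) := by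
          rw [Finset.mul_sum]
          exact Finset.sum_le_sum fun σ hσ =>
            T.size_le_mul_sum_spacing hD (mem_words_of_mem_descendants hσ₀ hσ)
        have hw0 : 0 ≤ w ^ ((s : ℝ) - 1) := by
          have : S.Nonempty := by
            obtain ⟨τ, hτ⟩ : (descendants n σ₀ m).Nonempty := by
              rw [← Finset.card_pos]
              have h1 := card_descendants_mul (m := m) hσ₀
              have h2 : 0 < wordCount n (k + m) := by exact_mod_cast T.wordCount_pos (k + m)
              exact Nat.pos_of_mul_pos_right (h1 ▸ h2)
            have := T.two_le (k + m)
            exact ⟨(τ, 1), Finset.mem_product.2 ⟨hτ, Finset.mem_Ico.2 ⟨le_rfl, by omega⟩⟩⟩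
          obtain ⟨p, hp⟩ := this
          exact Real.rpow_nonneg ((hLpos p hp).le.trans (hLw p hp)) _
        calc _ ≤ 2 * κ / (1 + H) * w ^ ((s : ℝ) - 1) * ((1 + H) * ∑ σ ∈ descendants n σ₀ m,
              ∑ j ∈ Finset.Ico 1 (n (k + m + 1)), L (σ, j)) := by gcongr
          _ = _ := by field_simp
    _ = ∑ p ∈ S, ENNReal.ofReal (2 * (κ * L p)) ^ (s : ℝ) := by
        rw [ENNReal.ofReal_sum_of_nonneg fun p hp => Real.rpow_nonneg
          (by have := hLpos p hp; positivity) _]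
        exact Finset.sum_congr rfl fun p hp => (ENNReal.ofReal_rpow_of_pos
          (by have := hLpos p hp; positivity)).symm

theorem spacing_le_div_wordCount (T : HullTree n χ d g u) {k j : ℕ} (hj : 1 ≤ j)
    (hjn : j < n (k + 1)) :
    d (k + 1) + g (k + 1) j ≤ 2 * χ * d 0 / wordCount n (k + 1) := by
  have h1 := T.mul_spacing_le hj hjn
  have h2 := T.wordCount_mul_d_le k
  have h3 := T.wordCount_pos k
  have hχ := T.one_le
  rw [le_div_iff₀ (T.wordCount_pos _), wordCount_succ]
  push_cast
  calc (d (k + 1) + g (k + 1) j) * (wordCount n k * n (k + 1))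
      = wordCount n k * (n (k + 1) * (d (k + 1) + g (k + 1) j)) := by ring
    _ ≤ wordCount n k * (2 * χ * d k) := by gcongr
    _ = 2 * χ * (wordCount n k * d k) := by ring
    _ ≤ _ := by gcongr

/-- The images of the hulls that descend from `σ₀` carry packings whose sums of `s`-th powers are
unbounded, for each `s < 1`. -/
theorem packingPremeasure_image_eq_top (T : HullTree n χ d g u) {f : ℝ → ℝ}
    (hD : IsDoublingSize (fun x y => |f y - f x|) H)
    (hM : ∀ ε : ℝ, 0 < ε → ∀ K, ∃ k ≥ K, (wordCount n (k + 1) : ℝ) ^ (-ε) < wordCount n k * d k)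
    {s : ℝ≥0} (hs : s < 1) {k₀ : ℕ} {σ₀ : List ℕ} (hσ₀ : σ₀ ∈ words n k₀) {A : Set ℝ}
    (hA : ∀ m, ∀ τ ∈ descendants n σ₀ m, f (u τ) ∈ A) : packingPremeasure s A = ∞ := by
  have hχ := T.one_le
  have hs' : (s : ℝ) < 1 := by exact_mod_cast hs
  obtain ⟨q, hq, hhold⟩ := hD.exists_holder
  obtain ⟨C, hC, hCq⟩ := hhold (u []) (u [] + d 0) (by linarith [T.d_pos 0])
  -- the surplus exponent, half of which is spent on the losses in the gaps
  set e := q * (1 - (s : ℝ)) with he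
  have he0 : 0 < e := mul_pos hq (by linarith)
  set θ : ℝ := 2 ^ (-(e / 4)) with hθ
  have hθ0 : 0 < θ := by positivity
  have hθ1 : θ < 1 := Real.rpow_lt_one_of_one_lt_of_neg (by norm_num) (by linarith)
  obtain ⟨a, ha⟩ := T.exists_size_descendants_ge hD hθ0 hθ1
  obtain ⟨c, hc, hpack⟩ := T.exists_le_packingSup hD hs.le
  have hdpos := T.d_pos 0
  set C' : ℝ := C * (2 * χ * d 0) ^ q with hC'
  have hC'0 : 0 < C' := by positivity
  have hD0 : 0 < |f (u σ₀ + d k₀) - f (u σ₀)| := hD.pos (by linarith [T.d_pos k₀])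
  have hNk0 := T.wordCount_pos k₀
  have hdk0 := T.d_pos k₀
  set c' : ℝ := c * C' ^ ((s : ℝ) - 1) * (((wordCount n k₀ * d k₀ : ℝ)⁻¹) ^ a *
    |f (u σ₀ + d k₀) - f (u σ₀)|) with hc'
  have hc'0 : 0 < c' := by positivity
  -- the packings of order `k + 1`
  have hmain : ∀ k ≥ k₀, (wordCount n (k + 1) : ℝ) ^ (-(e / (4 * (a + 1)))) <
      wordCount n k * d k → ∀ δ, C' * (wordCount n (k + 1) : ℝ) ^ (-q) ≤ δ →
      ENNReal.ofReal (c' * (wordCount n (k + 1) : ℝ) ^ (e / 2)) ≤ packingSup s δ A := by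
    intro k hk hkM δ hδ
    obtain ⟨m, rfl⟩ := Nat.exists_eq_add_of_le hk
    set N := (wordCount n (k₀ + m + 1) : ℝ) with hN
    have hN2 : (2 : ℝ) ^ (k₀ + m + 1) ≤ N := T.two_pow_le_wordCount_real _
    have hN1 : 1 ≤ N := (one_le_pow₀ (by norm_num)).trans hN2
    have hN0 : 0 < N := by linarith
    have hw : ∀ σ ∈ words n (k₀ + m), ∀ j, 1 ≤ j → j < n (k₀ + m + 1) →
        |f (u (σ ++ [j + 1])) - f (u (σ ++ [j]))| ≤ C' * N ^ (-q) := by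
      intro σ hσ j hj hjn
      have hσ' : σ ∈ descendants n [] (k₀ + m) := mem_descendants_nil.2 hσ
      have h0 := T.le_descendant (k := 0) rfl hσ'
      rw [zero_add] at h0
      have h1 := T.le_child hσ hj hjn.le
      have h2 := T.child_le hσ (j := j + 1) (by omega) hjn
      have h3 := T.step _ σ hσ j hj hjn
      have h4 := T.spacing_le_div_wordCount hj hjn
      have h5 := T.d_pos (k₀ + m + 1)
      have h6 := T.gap_nonneg _ j hj hjn
      refine (hCq (u (σ ++ [j])) (u (σ ++ [j + 1])) (by linarith) (by linarith)
        (by linarith)).trans ?_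
      rw [hC', mul_assoc, Real.rpow_neg hN0.le, ← div_eq_mul_inv,
        ← Real.div_rpow (by positivity) hN0.le]
      gcongr
      · linarith
      · linarith
    refine le_trans (ENNReal.ofReal_le_ofReal ?_)
      (hpack k₀ m σ₀ hσ₀ A (hA (m + 1)) _ δ hδ hw)
    have hF := ha k₀ σ₀ hσ₀ m
    have hθm : N ^ (-(e / 4)) ≤ θ ^ m := by
      calc N ^ (-(e / 4)) ≤ ((2 : ℝ) ^ (k₀ + m + 1)) ^ (-(e / 4)) :=
            Real.rpow_le_rpow_of_nonpos (by positivity) hN2 (by linarith)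
        _ = θ ^ (k₀ + m + 1) := by
            rw [hθ, ← Real.rpow_natCast, ← Real.rpow_natCast, ← Real.rpow_mul (by norm_num),
              ← Real.rpow_mul (by norm_num), mul_comm]
        _ ≤ θ ^ m := pow_le_pow_of_le_one hθ0.le hθ1.le (by omega)
    have hMa : N ^ (-(e / 4)) * ((wordCount n k₀ * d k₀ : ℝ)⁻¹) ^ a ≤
        (wordCount n (k₀ + m) * d (k₀ + m) / (wordCount n k₀ * d k₀)) ^ a := by
      rw [div_eq_mul_inv (wordCount n (k₀ + m) * d (k₀ + m)), mul_pow]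
      gcongr ?_ * _
      calc N ^ (-(e / 4)) ≤ N ^ (-(e / (4 * (a + 1))) * a) := by
            refine Real.rpow_le_rpow_of_exponent_le hN1 ?_
            rw [neg_mul, neg_le_neg_iff, div_mul_eq_mul_div, div_le_div_iff₀ (by positivity)
              (by norm_num)]
            nlinarith
        _ = (N ^ (-(e / (4 * (a + 1))))) ^ a := by
            rw [Real.rpow_mul hN0.le, Real.rpow_natCast]
        _ ≤ _ := by gcongr
    have hexp : N ^ (e / 2) = N ^ e * (N ^ (-(e / 4)) * N ^ (-(e / 4))) := by
      rw [← Real.rpow_add hN0, ← Real.rpow_add hN0]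
      congr 1
      ring
    have hwe : (C' * N ^ (-q)) ^ ((s : ℝ) - 1) = C' ^ ((s : ℝ) - 1) * N ^ e := by
      rw [Real.mul_rpow hC'0.le (by positivity), ← Real.rpow_mul hN0.le, he]
      congr 2
      ring
    calc c' * N ^ (e / 2) = c * (C' ^ ((s : ℝ) - 1) * N ^ e) *
          (N ^ (-(e / 4)) * (N ^ (-(e / 4)) * ((wordCount n k₀ * d k₀ : ℝ)⁻¹) ^ a) *
            |f (u σ₀ + d k₀) - f (u σ₀)|) := by rw [hexp, hc']; ring
      _ ≤ c * (C' ^ ((s : ℝ) - 1) * N ^ e) * (θ ^ m *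
          (wordCount n (k₀ + m) * d (k₀ + m) / (wordCount n k₀ * d k₀)) ^ a *
            |f (u σ₀ + d k₀) - f (u σ₀)|) := by gcongr
      _ ≤ _ := by
          rw [hwe]
          gcongr
  have hNtop : Filter.Tendsto (fun k => (wordCount n (k + 1) : ℝ)) Filter.atTop Filter.atTop :=
    Filter.tendsto_atTop_mono (fun k => (pow_le_pow_right₀ (by norm_num) (Nat.le_succ k)).trans
      (T.two_pow_le_wordCount_real (k + 1))) (tendsto_pow_atTop_atTop_of_one_lt one_lt_two)
  refine iInf₂_eq_top.2 fun δ hδ => ENNReal.eq_top_of_forall_nnreal_le fun R => ?_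
  have ht1 : Filter.Tendsto (fun k => C' * (wordCount n (k + 1) : ℝ) ^ (-q)) Filter.atTop
      (nhds 0) := by
    simpa using ((tendsto_rpow_neg_atTop hq).comp hNtop).const_mul C'
  have ht2 : Filter.Tendsto (fun k => c' * (wordCount n (k + 1) : ℝ) ^ (e / 2)) Filter.atTop
      Filter.atTop :=
    ((tendsto_rpow_atTop (half_pos he0)).comp hNtop).const_mul_atTop hc'0
  obtain ⟨K, hK⟩ := Filter.eventually_atTop.1 ((ht1.eventually_le_const hδ).and
    (ht2.eventually_ge_atTop (R : ℝ)))
  obtain ⟨k, hk, hkM⟩ := hM (e / (4 * (a + 1))) (by positivity) (max k₀ K)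
  obtain ⟨h1, h2⟩ := hK k ((le_max_right _ _).trans hk)
  refine le_trans ?_ (hmain k ((le_max_left _ _).trans hk) hkM δ h1)
  rw [← ENNReal.ofReal_coe_nnreal]
  exact ENNReal.ofReal_le_ofReal h2

end HullTree

/-! ### The hull tree of a homogeneous perfect set -/

namespace HasHomogeneousPerfectStructure

variable {a b : ℝ} {n : ℕ → ℕ} {c : ℕ → ℝ} {ξ : ℕ → ℕ → ℝ} {lo hi : List ℕ → ℝ}

/-- The length of the basic intervals of order `k`. -/
noncomputable def basicLength (a b : ℝ) (c : ℕ → ℝ) (k : ℕ) : ℝ :=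
  (b - a) * ∏ i ∈ Finset.range k, c (i + 1)

/-- The distance from the left endpoint of a basic interval of order `k` to the set. -/
noncomputable def leftMargin (ξ : ℕ → ℕ → ℝ) (k : ℕ) : ℝ := ∑' i, ξ (k + i + 1) 0

/-- The distance from the set to the right endpoint of a basic interval of order `k`. -/
noncomputable def rightMargin (n : ℕ → ℕ) (ξ : ℕ → ℕ → ℝ) (k : ℕ) : ℝ :=
  ∑' i, ξ (k + i + 1) (n (k + i + 1))

theorem basicLength_pos (h : HasHomogeneousPerfectStructure a b n c ξ lo hi) (k : ℕ) :
    0 < basicLength a b c k :=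
  mul_pos (sub_pos.2 h.initial_lt) (Finset.prod_pos fun i _ => h.c_pos i)

theorem basicLength_succ (k : ℕ) :
    basicLength a b c (k + 1) = basicLength a b c k * c (k + 1) := by
  rw [basicLength, basicLength, Finset.prod_range_succ, mul_assoc]

theorem hi_sub_lo (h : HasHomogeneousPerfectStructure a b n c ξ lo hi) {k : ℕ} {σ : List ℕ}
    (hσ : σ ∈ words n k) : hi σ - lo σ = basicLength a b c k := by
  induction k generalizing σ with
  | zero =>
    rw [words, mem_singleton_iff] at hσ
    simp [hσ, h.lo_nil, h.hi_nil, basicLength]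
  | succ k ih =>
    obtain ⟨τ, hτ, j, hj, rfl⟩ := hσ
    have h1 := h.ratio k τ hτ j hj
    rw [ih hτ, div_eq_iff (h.basicLength_pos k).ne'] at h1
    rw [h1, basicLength_succ, mul_comm]

theorem basicLength_succ_le (h : HasHomogeneousPerfectStructure a b n c ξ lo hi) (k : ℕ) :
    basicLength a b c (k + 1) ≤ basicLength a b c k * (1 / 2) := by
  rw [basicLength_succ]
  have h1 : (2 : ℝ) ≤ n (k + 1) := by exact_mod_cast h.two_le k
  have h2 : c (k + 1) ≤ 1 / 2 := by nlinarith [h.mul_lt_one k, h.c_pos k]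
  exact mul_le_mul_of_nonneg_left h2 (h.basicLength_pos k).le

theorem tendsto_basicLength (h : HasHomogeneousPerfectStructure a b n c ξ lo hi) :
    Filter.Tendsto (basicLength a b c) Filter.atTop (nhds 0) := by
  refine squeeze_zero (fun k => (h.basicLength_pos k).le)
    (g := fun k => basicLength a b c 0 * (1 / 2) ^ k) (fun k => ?_) ?_
  · induction k with
    | zero => simp
    | succ k ih =>
      rw [pow_succ, ← mul_assoc]
      exact (h.basicLength_succ_le k).trans (by gcongr)
  · simpa using (tendsto_pow_atTop_nhds_zero_of_lt_one (r := (1 / 2 : ℝ)) (by norm_num)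
      (by norm_num)).const_mul (basicLength a b c 0)

theorem hi_one_le_lo (h : HasHomogeneousPerfectStructure a b n c ξ lo hi) {k : ℕ} {σ : List ℕ}
    (hσ : σ ∈ words n k) : hi (σ ++ [1]) ≤ lo (σ ++ [n (k + 1)]) := by
  have hind : ∀ l, 2 ≤ l → l ≤ n (k + 1) → hi (σ ++ [1]) ≤ lo (σ ++ [l]) := by
    intro l hl
    induction l, hl using Nat.le_induction with
    | base =>
      intro hn
      exact h.ordered k σ hσ 1 (Finset.mem_Icc.2 ⟨le_rfl, by omega⟩)
    | succ l hl ih =>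
      intro hn
      have h1 := h.ordered k σ hσ l (Finset.mem_Icc.2 ⟨by omega, by omega⟩)
      have h2 := h.hi_sub_lo (append_mem_words hσ (j := l)
        (Finset.mem_Icc.2 ⟨by omega, by omega⟩))
      linarith [ih (by omega), h.basicLength_pos (k + 1)]
  exact hind _ (h.two_le k) le_rfl

theorem exists_word (h : HasHomogeneousPerfectStructure a b n c ξ lo hi) (k : ℕ) :
    ∃ σ, σ ∈ words n k := by
  induction k with
  | zero => exact ⟨[], rfl⟩
  | succ k ih =>
    obtain ⟨σ, hσ⟩ := ih
    exact ⟨_, append_mem_words hσ (Finset.mem_Icc.2 ⟨le_rfl, by linarith [h.two_le k]⟩)⟩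

theorem margins_add_le (h : HasHomogeneousPerfectStructure a b n c ξ lo hi) (k : ℕ) :
    ξ (k + 1) 0 + ξ (k + 1) (n (k + 1)) + 2 * basicLength a b c (k + 1) ≤ basicLength a b c k := by
  obtain ⟨σ, hσ⟩ := h.exists_word k
  have hn := h.two_le k
  have h1 := h.hi_one_le_lo hσ
  have h2 := h.gap_left k σ hσ
  have h3 := h.gap_right k σ hσ
  have h4 := h.hi_sub_lo hσ
  have h5 := h.hi_sub_lo (append_mem_words hσ (j := 1) (Finset.mem_Icc.2 ⟨le_rfl, by omega⟩))
  have h6 := h.hi_sub_lo (append_mem_words hσ (j := n (k + 1))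
    (Finset.mem_Icc.2 ⟨by omega, le_rfl⟩))
  linarith

theorem sum_margins_le (h : HasHomogeneousPerfectStructure a b n c ξ lo hi) (k m : ℕ) :
    ∑ i ∈ Finset.range m, (ξ (k + i + 1) 0 + ξ (k + i + 1) (n (k + i + 1))) ≤
      basicLength a b c k - basicLength a b c (k + m) := by
  induction m with
  | zero => simp
  | succ m ih =>
    rw [Finset.sum_range_succ, ← add_assoc k]
    linarith [h.margins_add_le (k + m), h.basicLength_pos (k + m + 1)]

theorem summable_left (h : HasHomogeneousPerfectStructure a b n c ξ lo hi) (k : ℕ) :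
    Summable fun i => ξ (k + i + 1) 0 :=
  summable_of_sum_range_le (c := basicLength a b c k) (fun i => h.gap_nonneg _ _ (Nat.zero_le _))
    fun m => (Finset.sum_le_sum fun i _ => le_add_of_nonneg_right
      (h.gap_nonneg _ _ le_rfl)).trans
      ((h.sum_margins_le k m).trans (by linarith [h.basicLength_pos (k + m)]))

theorem summable_right (h : HasHomogeneousPerfectStructure a b n c ξ lo hi) (k : ℕ) :
    Summable fun i => ξ (k + i + 1) (n (k + i + 1)) :=
  summable_of_sum_range_le (c := basicLength a b c k) (fun i => h.gap_nonneg _ _ le_rfl)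
    fun m => (Finset.sum_le_sum fun i _ => le_add_of_nonneg_left
      (h.gap_nonneg _ _ (Nat.zero_le _))).trans
      ((h.sum_margins_le k m).trans (by linarith [h.basicLength_pos (k + m)]))

theorem leftMargin_nonneg (h : HasHomogeneousPerfectStructure a b n c ξ lo hi) (k : ℕ) :
    0 ≤ leftMargin ξ k := tsum_nonneg fun _ => h.gap_nonneg _ _ (Nat.zero_le _)

theorem rightMargin_nonneg (h : HasHomogeneousPerfectStructure a b n c ξ lo hi) (k : ℕ) :
    0 ≤ rightMargin n ξ k := tsum_nonneg fun _ => h.gap_nonneg _ _ le_rfl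

theorem leftMargin_eq (h : HasHomogeneousPerfectStructure a b n c ξ lo hi) (k : ℕ) :
    leftMargin ξ k = ξ (k + 1) 0 + leftMargin ξ (k + 1) := by
  rw [leftMargin, (h.summable_left k).tsum_eq_zero_add, leftMargin]
  simp only [add_zero, add_comm, add_left_comm]

theorem rightMargin_eq (h : HasHomogeneousPerfectStructure a b n c ξ lo hi) (k : ℕ) :
    rightMargin n ξ k = ξ (k + 1) (n (k + 1)) + rightMargin n ξ (k + 1) := by
  rw [rightMargin, (h.summable_right k).tsum_eq_zero_add, rightMargin]
  simp only [add_zero, add_comm, add_left_comm]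

theorem leftMargin_add_rightMargin_le (h : HasHomogeneousPerfectStructure a b n c ξ lo hi)
    (k : ℕ) : leftMargin ξ k + rightMargin n ξ k ≤ basicLength a b c k := by
  rw [leftMargin, rightMargin, ← (h.summable_left k).tsum_add (h.summable_right k)]
  exact Real.tsum_le_of_sum_range_le
    (fun i => add_nonneg (h.gap_nonneg _ _ (Nat.zero_le _)) (h.gap_nonneg _ _ le_rfl))
    fun m => (h.sum_margins_le k m).trans (by linarith [h.basicLength_pos (k + m)])

/-- Cutting the margins off the basic intervals leaves a hull tree: the gaps between the shortened
intervals are the original gaps plus a term that depends on the order only. -/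
theorem hullTree (h : HasHomogeneousPerfectStructure a b n c ξ lo hi) {χ : ℝ} (hχ : 1 ≤ χ)
    (hξ : ∀ k, 1 ≤ k → ∀ l ∈ Finset.Icc 1 (n k - 1), ∀ l' ∈ Finset.Icc 1 (n k - 1),
      ξ k l ≤ χ * ξ k l') :
    HullTree n χ (fun k => basicLength a b c k - leftMargin ξ k - rightMargin n ξ k)
      (fun k j => ξ k j + leftMargin ξ k + rightMargin n ξ k)
      (fun σ => lo σ + leftMargin ξ σ.length) where
  two_le := h.two_le
  one_le := hχ
  d_pos k := by
    have h1 := h.margins_add_le k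
    have h2 := h.leftMargin_eq k
    have h3 := h.rightMargin_eq k
    have h4 := h.leftMargin_add_rightMargin_le (k + 1)
    have h5 := h.basicLength_pos (k + 1)
    linarith
  gap_nonneg k j hj hjn := by
    linarith [h.gap_nonneg k j hjn.le, h.leftMargin_nonneg (k + 1), h.rightMargin_nonneg (k + 1)]
  gap_le k j j' hj hjn hj' hjn' := by
    have h1 := hξ (k + 1) (by omega) j (Finset.mem_Icc.2 ⟨hj, by omega⟩) j'
      (Finset.mem_Icc.2 ⟨hj', by omega⟩)
    have h2 := le_mul_of_one_le_left (h.leftMargin_nonneg (k + 1)) hχ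
    have h3 := le_mul_of_one_le_left (h.rightMargin_nonneg (k + 1)) hχ
    rw [mul_add, mul_add]
    linarith
  first k σ hσ := by
    simp only [List.length_append, List.length_singleton, length_of_mem_words hσ]
    linarith [h.gap_left k σ hσ, h.leftMargin_eq k]
  step k σ hσ j hj hjn := by
    simp only [List.length_append, List.length_singleton, length_of_mem_words hσ]
    have h1 := h.gap k σ hσ j (Finset.mem_Icc.2 ⟨hj, by omega⟩)
    have h2 := h.hi_sub_lo (append_mem_words hσ (j := j) (Finset.mem_Icc.2 ⟨hj, hjn.le⟩))
    linarith
  last k σ hσ := by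
    simp only [List.length_append, List.length_singleton, length_of_mem_words hσ]
    have hn := h.two_le k
    have h1 := h.gap_right k σ hσ
    have h2 := h.hi_sub_lo (append_mem_words hσ (j := n (k + 1))
      (Finset.mem_Icc.2 ⟨by omega, le_rfl⟩))
    have h3 := h.hi_sub_lo hσ
    have h4 := h.rightMargin_eq k
    linarith

theorem add_leftMargin_mem_Icc (h : HasHomogeneousPerfectStructure a b n c ξ lo hi) {k : ℕ}
    {σ : List ℕ} (hσ : σ ∈ words n k) : lo σ + leftMargin ξ σ.length ∈ Icc (lo σ) (hi σ) := by
  rw [length_of_mem_words hσ]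
  have h1 := h.hi_sub_lo hσ
  exact ⟨by linarith [h.leftMargin_nonneg k],
    by linarith [h.leftMargin_add_rightMargin_le k, h.rightMargin_nonneg k]⟩

theorem Icc_subset_of_mem_descendants (h : HasHomogeneousPerfectStructure a b n c ξ lo hi)
    {k m : ℕ} {σ τ : List ℕ} (hσ : σ ∈ words n k) (hτ : τ ∈ descendants n σ m) :
    Icc (lo τ) (hi τ) ⊆ Icc (lo σ) (hi σ) := by
  induction m generalizing τ with
  | zero => rw [descendants, Finset.mem_singleton] at hτ; rw [hτ]
  | succ m ih =>
    obtain ⟨ρ, hρ, j, hj, rfl⟩ := (mem_descendants_succ hσ).1 hτ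
    exact (h.subset _ ρ (mem_words_of_mem_descendants hσ hρ) j hj).trans (ih hρ)

/-- The left endpoints of the shortened intervals belong to the homogeneous perfect set: each of
them is also the left endpoint of intervals of all higher orders. -/
theorem add_leftMargin_mem (h : HasHomogeneousPerfectStructure a b n c ξ lo hi) {k : ℕ}
    {σ : List ℕ} (hσ : σ ∈ words n k) :
    lo σ + leftMargin ξ σ.length ∈ ⋂ k, ⋃ σ ∈ words n k, Icc (lo σ) (hi σ) := by
  refine mem_iInter.2 fun K => ?_
  rcases le_total K k with hK | hK
  · obtain ⟨m, rfl⟩ := Nat.exists_eq_add_of_le hK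
    obtain ⟨τ, hτ, hστ⟩ := exists_descendants_of_mem_words hσ
    exact mem_iUnion₂.2 ⟨τ, hτ, h.Icc_subset_of_mem_descendants hτ hστ
      (h.add_leftMargin_mem_Icc hσ)⟩
  · obtain ⟨m, rfl⟩ := Nat.exists_eq_add_of_le hK
    have hex : ∃ τ ∈ words n (k + m),
        lo τ + leftMargin ξ τ.length = lo σ + leftMargin ξ σ.length := by
      clear hK
      induction m with
      | zero => exact ⟨σ, hσ, rfl⟩
      | succ m ih =>
        obtain ⟨τ, hτ, hτe⟩ := ih
        refine ⟨τ ++ [1], append_mem_words hτ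
          (Finset.mem_Icc.2 ⟨le_rfl, one_le_two.trans (h.two_le (k + m))⟩), ?_⟩
        rw [← hτe, List.length_append, List.length_singleton, length_of_mem_words hτ]
        linarith [h.gap_left _ τ hτ, h.leftMargin_eq (k + m)]
    obtain ⟨τ, hτ, hτe⟩ := hex
    exact mem_iUnion₂.2 ⟨τ, hτ, hτe ▸ h.add_leftMargin_mem_Icc hτ⟩

theorem exists_abs_sub_le (h : HasHomogeneousPerfectStructure a b n c ξ lo hi) {r : ℝ}
    (hr : 0 < r) : ∃ L₀, ∀ L ≥ L₀, ∀ x ∈ ⋂ k, ⋃ σ ∈ words n k, Icc (lo σ) (hi σ),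
      ∃ τ ∈ words n L, |x - (lo τ + leftMargin ξ τ.length)| ≤ r := by
  obtain ⟨L₀, hL₀⟩ := Filter.eventually_atTop.1 (h.tendsto_basicLength.eventually_le_const hr)
  refine ⟨L₀, fun L hL x hx => ?_⟩
  obtain ⟨τ, hτ, hxτ⟩ := mem_iUnion₂.1 (mem_iInter.1 hx L)
  refine ⟨τ, hτ, (abs_sub_le_of_le_of_le hxτ.1 hxτ.2 (h.add_leftMargin_mem_Icc hτ).1
    (h.add_leftMargin_mem_Icc hτ).2).trans ?_⟩
  rw [h.hi_sub_lo hτ]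
  exact hL₀ L hL

theorem isClosed (n : ℕ → ℕ) (lo hi : List ℕ → ℝ) :
    IsClosed (⋂ k, ⋃ σ ∈ words n k, Icc (lo σ) (hi σ)) := by
  refine isClosed_iInter fun k => ?_
  have hfin : (words n k).Finite :=
    (descendants n [] k).finite_toSet.subset fun σ hσ => mem_descendants_nil.2 hσ
  exact hfin.isClosed_biUnion fun σ _ => isClosed_Icc

theorem subset_Icc (h : HasHomogeneousPerfectStructure a b n c ξ lo hi) :
    (⋂ k, ⋃ σ ∈ words n k, Icc (lo σ) (hi σ)) ⊆ Icc a b := by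
  intro x hx
  obtain ⟨σ, hσ, hxσ⟩ := mem_iUnion₂.1 (mem_iInter.1 hx 0)
  rw [words, mem_singleton_iff] at hσ
  rwa [hσ, h.lo_nil, h.hi_nil] at hxσ

end HasHomogeneousPerfectStructure

open HasHomogeneousPerfectStructure in
theorem IsHomogeneousPerfectSet.packingDim_image_eq_one {a b : ℝ} {n : ℕ → ℕ} {c : ℕ → ℝ}
    {ξ : ℕ → ℕ → ℝ} {E : Set ℝ} (hE : IsHomogeneousPerfectSet a b n c ξ E) {χ : ℝ} (hχ : 1 ≤ χ)
    (hξ : ∀ k, 1 ≤ k → ∀ l ∈ Finset.Icc 1 (n k - 1), ∀ l' ∈ Finset.Icc 1 (n k - 1),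
      ξ k l ≤ χ * ξ k l')
    (hdim : packingDim E = 1) {f : ℝ → ℝ} (hf : IsQuasisymmetric f) :
    packingDim (f '' E) = 1 := by
  obtain ⟨lo, hi, h, rfl⟩ := hE
  set E := ⋂ k, ⋃ σ ∈ words n k, Icc (lo σ) (hi σ) with hEdef
  have T := h.hullTree hχ hξ
  have hcont := hf.1.continuous
  obtain ⟨H, hD⟩ := hf.exists_isDoublingSize
  have hM := fun ε (hε : (0 : ℝ) < ε) K =>
    T.exists_rpow_lt h.subset_Icc (fun r hr => h.exists_abs_sub_le hr) hdim hε K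
  refine le_antisymm ?_ (one_le_packingDim_of_forall fun s hs => ?_)
  · have hcomp : IsCompact (f '' E) :=
      (isCompact_Icc.of_isClosed_subset (isClosed n lo hi) h.subset_Icc).image hcont
    obtain ⟨A, hA⟩ := hcomp.bddBelow
    obtain ⟨B, hB⟩ := hcomp.bddAbove
    refine (packingDim_le_of_forall (s₀ := 1) fun s hs => ?_).trans_eq ENNReal.coe_one
    exact packingMeasure_ne_top_of_one_le hs.le fun x hx => ⟨hA hx, hB hx⟩
  · have hne : (f '' E).Nonempty := ⟨_, mem_image_of_mem f (h.add_leftMargin_mem (k := 0) rfl)⟩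
    refine packingMeasure_eq_top_of_forall_isOpen (hf.1.isClosedMap _ (isClosed n lo hi)) hne
      fun V hV hVne => ?_
    obtain ⟨_, ⟨x, hx, rfl⟩, hxV⟩ := hVne
    obtain ⟨r, hr, hball⟩ := Metric.isOpen_iff.1 (hV.preimage hcont) x hxV
    -- a hull interval inside the preimage of `V`
    obtain ⟨L₀, hL₀⟩ := h.exists_abs_sub_le (show 0 < r / 4 by linarith)
    obtain ⟨L, hLd, hL⟩ := ((T.tendsto_d.eventually_le_const (show 0 < r / 4 by linarith)).and
      (Filter.eventually_ge_atTop L₀)).exists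
    obtain ⟨τ, hτ, hxτ⟩ := hL₀ L hL x hx
    refine T.packingPremeasure_image_eq_top hD hM hs hτ fun m ρ hρ => ⟨mem_image_of_mem f
      (h.add_leftMargin_mem (mem_words_of_mem_descendants hτ hρ)), hball ?_⟩
    have h1 := T.le_descendant hτ hρ
    have h2 := T.d_pos (L + m)
    have h3 := abs_le.1 hxτ
    rw [Metric.mem_ball, Real.dist_eq, abs_lt]
    constructor <;> linarith

theorem theorem3p1 (a b : ℝ) (n : ℕ → ℕ) (c : ℕ → ℝ) (ξ : ℕ → ℕ → ℝ) (E : Set ℝ)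
    (hE : IsHomogeneousPerfectSet a b n c ξ E)
    (χ : ℝ) (hχ : 1 ≤ χ)
    (hξ : ∀ k, 1 ≤ k → ∀ l ∈ Finset.Icc 1 (n k - 1), ∀ l' ∈ Finset.Icc 1 (n k - 1),
      ξ k l ≤ χ * ξ k l')
    (hdim : packingDim E = 1) :
    (∀ f : ℝ → ℝ, IsQuasisymmetric f → packingDim (f '' E) = 1) ∧
      IsQuasisymmetricallyPackingMinimal E := by
  have h := fun f (hf : IsQuasisymmetric f) => hE.packingDim_image_eq_one hχ hξ hdim hf
  exact ⟨h, fun f hf => by rw [hdim, h f hf]⟩
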